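/- Let $\Omega\subset\mathbb{C}$ be a domain (a nonempty connected open set, not necessarily bounded). For $x\in\mathbb{R}$ put $\Omega_x=\Omega\cap\{\operatorname{Re} z=x\}$, let $|\Omega_x|$ be its one-dimensional Lebesgue measure, and let $l(x)\in[0,\infty]$ be the length of the longest interval contained in $\Omega_x$ (with $l(x)=0$ if $\Omega_x=\varnothing$). Suppose that there is $M<\infty$ with $|\Omega_x|\le M$ for all $x$. Let $z_0=x_0+iy_0$ and $r_0>0$ be such that $B(z_0,r_0)\subset\Omega$, let $b>x_0$, and put $E_b=\partial\Omega\cap\{\operatorname{Re} z\ge b\}$, where $\partial\Omega$ is the boundary of $\Omega$ in $\mathbb{C}$. Let $\omega(z_0,E_b,\Omega)$ be the harmonic measure of $E_b$ at $z_0$, that is, the value at $z_0$ of the Perron solution of the Dirichlet problem in $\Omega$ with boundary data $1_{E_b}$: the supremum of $v(z_0)$ over all functions $v$ that are subharmonic and bounded above in $\Omega$ and satisfy $\limsup_{z\to\zeta,\,z\in\Omega}v(z)\le 1_{E_b}(\zeta)$ for every $\zeta\in\partial\Omega$. Then $$\omega(z_0,E_b,\Omega)\;\le\;\frac{3M}{\Bigl(2\pi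 r_0\displaystyle\int_{x_0}^{b}\exp\Bigl(2\pi\int_{x_0}^{t}\frac{dx}{l(x)}\Bigr)\,dt\Bigr)^{1/2}},$$ where the integrals are taken in $[0,\infty]$ with $1/0=\infty$, $e^{\infty}=\infty$ and $3M/\infty=0$. -/

import Mathlib

open Set Filter Topology MeasureTheory
open scoped NNReal ENNReal

namespace Carleman

/-- `v` is a (finite-valued) subharmonic function on `U`: it is upper semicontinuous on `U`, and on
every closed disc contained in `U` its value at the centre is at most its mean over the circle. -/
structure SubharmonicOn (v : ℂ → ℝ) (U : Set ℂ) : Prop where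
  usc : UpperSemicontinuousOn v U
  circleIntegrable : ∀ c : ℂ, ∀ r : ℝ, 0 < r → Metric.closedBall c r ⊆ U → CircleIntegrable v c r
  le_circleAverage : ∀ c : ℂ, ∀ r : ℝ, 0 < r → Metric.closedBall c r ⊆ U →
    v c ≤ Real.circleAverage v c r

/-- The Perron family of the Dirichlet problem on `Ω` with boundary data `φ`: the functions that are
subharmonic and bounded above on `Ω` and satisfy `limsup_{z → ζ, z ∈ Ω} v z ≤ φ ζ` at every (finite)
boundary point `ζ` of `Ω`. No condition is imposed at infinity. -/
structure PerronFamily (Ω : Set ℂ) (φ : ℂ → ℝ) (v : ℂ → ℝ) : Prop where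
  subharmonicOn : SubharmonicOn v Ω
  bddAbove : BddAbove (v '' Ω)
  limsup_le : ∀ ζ ∈ frontier Ω, ∀ ε > 0, ∀ᶠ z in 𝓝[Ω] ζ, v z < φ ζ + ε

/-- The harmonic measure `ω(z, E, Ω)` of `E ∩ ∂Ω` at `z ∈ Ω`: the value at `z` of the Perron
solution of the Dirichlet problem on `Ω` with boundary data the indicator function of `E`, that is,
the supremum of `v z` over the Perron family. The zero function belongs to this family, so the
supremum is nonnegative and it may be taken in `[0, ∞]`, after replacing `v z` by `max (v z) 0`. -/
noncomputable def harmonicMeasure (Ω : Set ℂ) (z : ℂ) (E : Set ℂ) : ℝ≥0∞ :=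
  ⨆ (v : ℂ → ℝ) (_ : PerronFamily Ω (E.indicator 1) v), ENNReal.ofReal (v z)

/-- The vertical cross-section `Ω_x = Ω ∩ {Re z = x}`, as a set of imaginary parts. -/
def crossSection (Ω : Set ℂ) (x : ℝ) : Set ℝ := {y | (⟨x, y⟩ : ℂ) ∈ Ω}

/-- The length `l(x)` of the longest open interval contained in `Ω_x`. -/
noncomputable def longestInterval (Ω : Set ℂ) (x : ℝ) : ℝ≥0∞ :=
  ⨆ (a : ℝ) (b : ℝ) (_ : Ioo a b ⊆ crossSection Ω x), ENNReal.ofReal (b - a)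

/-- The integral `∫_{x₀}^b exp (2π ∫_{x₀}^t dx / l(x)) dt`, with values in `[0, ∞]`
(with the conventions `1 / 0 = ∞` and `exp ∞ = ∞`). -/
noncomputable def carlemanIntegral (Ω : Set ℂ) (x₀ b : ℝ) : ℝ≥0∞ :=
  ∫⁻ t in Ioc x₀ b,
    EReal.exp ((ENNReal.ofReal (2 * Real.pi) * ∫⁻ x in Ioc x₀ t, (longestInterval Ω x)⁻¹ : ℝ≥0∞) :
      EReal)

/-- The part `E_b = ∂Ω ∩ {Re z ≥ b}` of the boundary. -/
def boundaryBeyond (Ω : Set ℂ) (b : ℝ) : Set ℂ := frontier Ω ∩ {z | b ≤ z.re}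

end Carleman

/-!
# Carleman's estimate of harmonic measure in terms of the longest cross-sectional intervals

Let `v` belong to the Perron family of `1_{E_b}` and let `u = max v 0` on `Ω`, extended by zero. On
the half-plane `Re z < b` the boundary values of `v` are at most zero, so `u` is upper
semicontinuous and has the sub-mean value property there. The estimate comes from *Carleman's
method*: for `A(x) = ∫ u(x + iy)² dy` the subharmonicity of `u` and Wirtinger's inequality on the
intervals of `Ω_x`, which have length at most `l(x)`, give
`A'' ≥ 2 ∫ u_x² + 2 ∫ u_y² ≥ 2 ∫ u_x² + 2 (π / l)² ∫ u² ≥ (2 π / l) A'`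
(`IsCarlemanTest.mul_inv_longestInterval_le`). Hence `log A'` grows at least like `2 π ∫ dx / l`,
and `A'(s) ∫_s^t exp (2 π ∫_s^τ dx / l) dτ ≤ A(t) - A(s)`
(`IsCarlemanTest.carlemanIntegral_le`).
As `l ≤ M` and as `A` and `A'` vanish at `-∞`, the same inequality yields `A' ≥ (2 π / M) A`
(`IsCarlemanTest.mul_sliceEnergy_le`). Together with `A ≤ M`, which holds because `u ≤ 1`, this
bounds `A(s)` and the Carleman integral in terms of each other. At the abscissa `s = x₀ + r₀ / 5` a
lower bound for `A(s)` in terms of `v(z₀)` is the mean value inequality for `u²` on the disc of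
radius `r₀ / 5` about `z₀` (`IsCarlemanTest.mul_sq_le_sliceEnergy`). Moving the left endpoint from
`s` back to `x₀` costs a factor `e`, and the constant `3` of the theorem leaves room for it since
`10 e < 9 π` (`carlemanIntegral_le_add`, `exp_mul_add_le`).

The function `u` is only upper semicontinuous, and its support may be unbounded, so `A` cannot be
differentiated directly. Two facts repair this.

* The sub-mean value property is local (`le_circleAverage_of_eventually`), by the maximum principle
  against real parts of entire functions, which are dense in the continuous functions on a circle.
  So `u` satisfies it on all discs in the half-plane, including those that cross `∂Ω`. Since `Ω` has
  small area in most discs, this gives `u ≤ 1` (`PerronFamily.le_one`) and the decay of `u` at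
  infinity: the sets `{u ≥ δ, Re z ≤ b'}` with `b' < b` are compact subsets of `Ω`
  (`PerronFamily.isCompact_superlevel`).
* Consequently `max (u - δ) 0` has compact support in `Ω` to the left of `b'`, and so has its
  convolution `w` with a radial kernel of small support. The function `w` is smooth, and on a
  slightly smaller half-plane it is subharmonic and lies above `max (u - δ) 0`
  (`PerronFamily.exists_isCarlemanTest`). Carleman's method is applied to `w`; no passage to the
  limit in the mollification is needed.
-/

namespace Carleman

open scoped ContDiff

/-! ### Sub-mean value inequalities on small circles and on all circles -/

theorem UpperSemicontinuousOn.circleIntegrable {u : ℂ → ℝ} {U : Set ℂ} {N : ℝ}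
    (husc : UpperSemicontinuousOn u U) (h0 : ∀ z, 0 ≤ u z) (hN : ∀ z, u z ≤ N) {c : ℂ} {R : ℝ}
    (hs : Metric.sphere c |R| ⊆ U) : CircleIntegrable u c R := by
  have hmeas : Measurable fun θ => u (circleMap c R θ) := by
    apply UpperSemicontinuous.measurable
    intro θ
    have h1 : UpperSemicontinuousWithinAt u U (circleMap c R θ) :=
      husc _ (hs (circleMap_mem_sphere' c R θ))
    intro y hy
    have h2 : Tendsto (circleMap c R) (𝓝 θ) (𝓝[U] (circleMap c R θ)) :=
      tendsto_nhdsWithin_iff.2 ⟨(continuous_circleMap c R).continuousAt,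
        Eventually.of_forall fun x => hs (circleMap_mem_sphere' c R x)⟩
    exact h2.eventually (h1 y hy)
  rw [CircleIntegrable, intervalIntegrable_iff]
  refine Measure.integrableOn_of_bounded (M := N) (by simp [ENNReal.mul_eq_top])
    hmeas.aestronglyMeasurable ?_
  exact Eventually.of_forall fun θ => by rw [Real.norm_of_nonneg (h0 _)]; exact hN _

theorem circleAverage_re_of_differentiable {F : ℂ → ℂ} (hF : Differentiable ℂ F) (c : ℂ) (R : ℝ) :
    Real.circleAverage (fun z => (F z).re) c R = (F c).re :=
  InnerProductSpace.HarmonicOnNhd.circleAverage_eq fun z _ =>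
    ((hF.analyticAt z)).harmonicAt_re

/-- The maximum principle, against a real part `h` of an entire function. If `u - h` were positive
at the centre, then `u - h + ε |z - c|²` would have an interior maximum for small `ε`, against its
strict sub-mean value property. -/
theorem le_re_of_le_on_sphere {u : ℂ → ℝ} {U : Set ℂ} {N : ℝ}
    (husc : UpperSemicontinuousOn u U) (h0 : ∀ z, 0 ≤ u z) (hN : ∀ z, u z ≤ N)
    (hloc : ∀ z ∈ U, ∀ᶠ r in 𝓝[>] (0 : ℝ), u z ≤ Real.circleAverage u z r)
    {c : ℂ} {R : ℝ} (hR : 0 < R) (hball : Metric.closedBall c R ⊆ U)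
    {F : ℂ → ℂ} (hF : Differentiable ℂ F)
    (hle : ∀ z ∈ Metric.sphere c R, u z ≤ (F z).re) : u c ≤ (F c).re := by
  by_contra! hlt
  -- with this `ε` the added term is at most half of `u c - h c`
  set ε := (u c - (F c).re) / (2 * R ^ 2) with hε
  have hεpos : 0 < ε := by have := sub_pos.2 hlt; positivity
  have hεR : ε * R ^ 2 = (u c - (F c).re) / 2 := by rw [hε]; field_simp
  set G : ℂ → ℝ := fun z => u z + (- (F z).re + ε * ‖z - c‖ ^ 2) with hG
  have hGusc : UpperSemicontinuousOn G (Metric.closedBall c R) := by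
    refine (husc.mono hball).add ?_
    refine ContinuousOn.upperSemicontinuousOn (Continuous.continuousOn ?_)
    have := hF.continuous
    fun_prop
  obtain ⟨z, hz, hmax⟩ := hGusc.exists_isMaxOn ⟨c, Metric.mem_closedBall_self hR.le⟩
    (isCompact_closedBall c R)
  have hGc : G c ≤ G z := hmax (Metric.mem_closedBall_self hR.le)
  have hzb : z ∈ Metric.ball c R := by
    rcases lt_or_eq_of_le (Metric.mem_closedBall.1 hz) with h | h
    · exact h
    · exfalso
      have h1 := hle z h
      have h2 : ‖z - c‖ = R := by rw [← dist_eq_norm]; exact h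
      simp only [hG, h2, sub_self, norm_zero] at hGc
      nlinarith
  obtain ⟨r₁, hr₁, hr₁b⟩ := Metric.isOpen_iff.1 Metric.isOpen_ball z hzb
  obtain ⟨r, hru, hr⟩ := ((hloc z (hball hz)).and (Ioo_mem_nhdsGT hr₁)).exists
  have hsub : Metric.sphere z |r| ⊆ Metric.closedBall c R := by
    rw [abs_of_pos hr.1]
    intro w hw
    exact Metric.ball_subset_closedBall (hr₁b (by
      rw [Metric.mem_ball, Metric.mem_sphere.1 hw]; exact hr.2))
  have hint := UpperSemicontinuousOn.circleIntegrable husc h0 hN (hsub.trans hball)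
  -- on the circle of radius `r` about `z`, the function `|w - c|²` agrees with a real affine one
  set H : ℂ → ℂ := fun w => F w + (G z : ℂ)
    - ε * (‖z - c‖ ^ 2 + r ^ 2 + 2 * ((w - z) * (starRingEnd ℂ) (z - c))) with hH
  have hHd : Differentiable ℂ H := by rw [hH]; fun_prop
  have hHre : ∀ w, (H w).re = (F w).re + G z - ε * (‖z - c‖ ^ 2 + r ^ 2 +
      2 * ((w - z) * (starRingEnd ℂ) (z - c)).re) := by
    intro w
    simp [hH, ← Complex.ofReal_pow]
  have hle2 : ∀ w ∈ Metric.sphere z |r|, u w ≤ (H w).re := by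
    intro w hw
    have h1 : G w ≤ G z := hmax (hsub hw)
    have h2 : ‖w - z‖ = r := by
      rw [← dist_eq_norm, Metric.mem_sphere.1 hw, abs_of_pos hr.1]
    have hsplit : w - c = (w - z) + (z - c) := by ring
    have h3 : ‖w - c‖ ^ 2 = ‖z - c‖ ^ 2 + r ^ 2 +
      2 * ((w - z) * (starRingEnd ℂ) (z - c)).re := by
      rw [← h2, ← Complex.normSq_eq_norm_sq, ← Complex.normSq_eq_norm_sq,
        ← Complex.normSq_eq_norm_sq, hsplit, Complex.normSq_add]
      ring
    rw [hHre, ← h3]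
    simp only [hG] at h1 ⊢
    linarith
  have h4 := Real.circleAverage_mono hint
    ((Complex.continuous_re.comp hHd.continuous).continuousOn.circleIntegrable') hle2
  rw [Function.comp_def, circleAverage_re_of_differentiable hHd, hHre] at h4
  have h5 : 0 < ε * r ^ 2 := mul_pos hεpos (pow_pos hr.1 2)
  simp only [hG, sub_self, zero_mul, Complex.zero_re] at h4 hru
  nlinarith

/-- On the unit circle every trigonometric polynomial has the real part of an entire function. -/
theorem exists_entire_re_eq_of_mem_span_fourier [Fact (0 < 2 * Real.pi)]
    {p : C(AddCircle (2 * Real.pi), ℂ)}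
    (hp : p ∈ Submodule.span ℂ (range (@fourier (2 * Real.pi)))) (a : ℂ) :
    ∃ F : ℂ → ℂ, Differentiable ℂ F ∧
      ∀ θ : ℝ, (a * p (θ : AddCircle (2 * Real.pi))).re = (F (Complex.exp (θ * Complex.I))).re := by
  induction hp using Submodule.span_induction generalizing a with
  | mem x hx =>
    obtain ⟨n, rfl⟩ := hx
    have key : ∀ (n : ℤ) (θ : ℝ), fourier n (θ : AddCircle (2 * Real.pi)) =
        Complex.exp (θ * Complex.I) ^ n := by
      intro n θ
      rw [fourier_coe_apply, ← Complex.exp_int_mul]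
      congr 1
      have : (Real.pi : ℂ) ≠ 0 := by exact_mod_cast Real.pi_ne_zero
      push_cast
      field_simp
    obtain ⟨m, rfl | rfl⟩ := n.eq_nat_or_neg
    · refine ⟨fun z => a * z ^ m, by fun_prop, fun θ => ?_⟩
      rw [key, zpow_natCast]
    · -- a negative power is the conjugate of a positive one on the circle
      refine ⟨fun z => (starRingEnd ℂ) a * z ^ m, by fun_prop, fun θ => ?_⟩
      simp only
      rw [fourier_neg, key, zpow_natCast, ← Complex.conj_re, map_mul, Complex.conj_conj]
  | zero => exact ⟨fun _ => 0, by fun_prop, fun θ => by simp⟩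
  | add x y _ _ hx hy =>
    obtain ⟨F, hF, hF'⟩ := hx a
    obtain ⟨G, hG, hG'⟩ := hy a
    refine ⟨fun z => F z + G z, by fun_prop, fun θ => ?_⟩
    rw [Complex.add_re, ← hF', ← hG', ← Complex.add_re, ContinuousMap.add_apply, mul_add]
  | smul b x _ hx =>
    obtain ⟨F, hF, hF'⟩ := hx (a * b)
    exact ⟨F, hF, fun θ => by rw [← hF', ContinuousMap.smul_apply, smul_eq_mul, mul_assoc]⟩

/-- Real parts of entire functions are uniformly dense in the continuous functions on a circle. -/
theorem exists_entire_re_near {f : ℂ → ℝ} (hf : Continuous f) (c : ℂ) {R : ℝ} (hR : 0 < R)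
    {η : ℝ} (hη : 0 < η) :
    ∃ F : ℂ → ℂ, Differentiable ℂ F ∧ ∀ z ∈ Metric.sphere c R, |f z - (F z).re| ≤ η := by
  have : Fact (0 < 2 * Real.pi) := ⟨Real.two_pi_pos⟩
  have hper : Function.Periodic (fun θ : ℝ => (f (circleMap c R θ) : ℂ)) (2 * Real.pi) := by
    intro θ
    simp only [(periodic_circleMap c R) θ]
  let q : C(AddCircle (2 * Real.pi), ℂ) :=
    ⟨hper.lift, by
      have h1 : Continuous fun θ : ℝ => (f (circleMap c R θ) : ℂ) := by fun_prop
      exact continuous_coinduced_dom.2 h1⟩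
  have hq : ∀ θ : ℝ, q (θ : AddCircle (2 * Real.pi)) = f (circleMap c R θ) := fun θ => rfl
  have hmem : q ∈ (Submodule.span ℂ (range (@fourier (2 * Real.pi)))).topologicalClosure := by
    rw [span_fourier_closure_eq_top]; trivial
  obtain ⟨p, hp, hpq⟩ := Metric.mem_closure_iff.1 hmem η hη
  obtain ⟨F, hF, hFp⟩ := exists_entire_re_eq_of_mem_span_fourier hp 1
  refine ⟨fun z => F ((z - c) / R), by fun_prop, fun z hz => ?_⟩
  obtain ⟨θ, rfl⟩ : ∃ θ, circleMap c R θ = z := by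
    rw [← abs_of_pos hR, ← range_circleMap] at hz
    exact hz
  have hR' : (R : ℂ) ≠ 0 := by exact_mod_cast hR.ne'
  have h1 : (circleMap c R θ - c) / R = Complex.exp (θ * Complex.I) := by
    rw [circleMap]; field_simp; ring
  have h2 : dist (q (θ : AddCircle (2 * Real.pi))) (p (θ : AddCircle (2 * Real.pi))) < η :=
    (ContinuousMap.dist_apply_le_dist _).trans_lt hpq
  simp only
  rw [h1, ← hFp, one_mul]
  calc |f (circleMap c R θ) - (p (θ : AddCircle (2 * Real.pi))).re|
      = |(q (θ : AddCircle (2 * Real.pi)) - p (θ : AddCircle (2 * Real.pi))).re| := by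
        rw [hq, Complex.sub_re, Complex.ofReal_re]
    _ ≤ _ := Complex.abs_re_le_norm _
    _ ≤ η := by rw [← dist_eq_norm]; exact h2.le

/-- A bounded upper semicontinuous function on a compact set is the pointwise limit there of
continuous functions that lie above it. -/
theorem exists_continuous_tendsto_of_upperSemicontinuousOn {u : ℂ → ℝ} {N : ℝ} {S : Set ℂ}
    (hS : S.Nonempty) (husc : UpperSemicontinuousOn u S) (h0 : ∀ z, 0 ≤ u z) (hN : ∀ z, u z ≤ N) :
    ∃ f : ℕ → ℂ → ℝ, (∀ n, Continuous (f n)) ∧ (∀ n, ∀ z ∈ S, u z ≤ f n z) ∧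
      (∀ n, ∀ z ∈ S, f n z ≤ N) ∧ ∀ z ∈ S, Tendsto (fun n => f n z) atTop (𝓝 (u z)) := by
  have : Nonempty S := hS.to_subtype
  have hbdd : ∀ (n : ℕ) (z : ℂ), BddAbove (range fun ζ : S => u ζ - n * dist z ζ) := by
    intro n z
    refine ⟨N, ?_⟩
    rintro _ ⟨ζ, rfl⟩
    have : 0 ≤ (n : ℝ) * dist z ζ := by positivity
    have := hN ζ
    simp only
    linarith
  have hle : ∀ n : ℕ, ∀ z ∈ S, u z ≤ ⨆ ζ : S, (u ζ - n * dist z ζ) := by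
    intro n z hz
    have := le_ciSup (hbdd n z) ⟨z, hz⟩
    simpa using this
  -- the sup-convolutions of `u` with the cones `n |z - ζ|`
  refine ⟨fun n z => ⨆ ζ : S, (u ζ - n * dist z ζ), fun n => ?_, hle, fun n z hz => ?_,
    fun z hz => ?_⟩
  · refine (LipschitzWith.of_le_add_mul (n : ℝ≥0) fun x y => ?_).continuous
    refine ciSup_le fun ζ => ?_
    have h1 := le_ciSup (hbdd n y) ζ
    have h2 := dist_triangle y x ζ
    rw [dist_comm y x] at h2
    have h3 : (n : ℝ) * dist y ζ ≤ n * (dist x y + dist x ζ) := by gcongr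
    simp only [NNReal.coe_natCast] at *
    linarith
  · refine ciSup_le fun ζ => ?_
    have : 0 ≤ (n : ℝ) * dist z ζ := by positivity
    have := hN ζ
    linarith
  · rw [Metric.tendsto_atTop]
    intro ε hε
    have h1 := husc z hz (u z + ε / 2) (by linarith)
    obtain ⟨δ, hδ, hδ'⟩ := Metric.mem_nhdsWithin_iff.1 h1
    obtain ⟨n₀, hn₀⟩ := exists_nat_gt (N / δ)
    refine ⟨n₀, fun n hn => ?_⟩
    have h2 : ⨆ ζ : S, (u ζ - n * dist z ζ) ≤ u z + ε / 2 := by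
      refine ciSup_le fun ζ => ?_
      rcases lt_or_ge (dist (ζ : ℂ) z) δ with h | h
      · have h3 : u ζ < u z + ε / 2 := hδ' ⟨h, ζ.2⟩
        have : 0 ≤ (n : ℝ) * dist z ζ := by positivity
        linarith
      · -- far from `z` the penalty exceeds the bound for `u`
        have h4 : (n₀ : ℝ) ≤ n := by exact_mod_cast hn
        have h5 : N < n * δ := (div_lt_iff₀ hδ).1 (hn₀.trans_le h4)
        have h6 : (n : ℝ) * δ ≤ n * dist z ζ := by rw [dist_comm]; gcongr
        have := hN ζ
        have := h0 z
        linarith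
    rw [Real.dist_eq, abs_lt]
    have := hle n z hz
    constructor <;> linarith

/-- The sub-mean value inequality is local: if a bounded upper semicontinuous function satisfies
it on small circles, then it satisfies it on all circles. -/
theorem le_circleAverage_of_eventually {u : ℂ → ℝ} {U : Set ℂ} {N : ℝ}
    (husc : UpperSemicontinuousOn u U) (h0 : ∀ z, 0 ≤ u z) (hN : ∀ z, u z ≤ N)
    (hloc : ∀ z ∈ U, ∀ᶠ r in 𝓝[>] (0 : ℝ), u z ≤ Real.circleAverage u z r)
    {c : ℂ} {R : ℝ} (hR : 0 < R) (hball : Metric.closedBall c R ⊆ U) :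
    u c ≤ Real.circleAverage u c R := by
  have hsub : Metric.sphere c R ⊆ U := Metric.sphere_subset_closedBall.trans hball
  obtain ⟨f, hfc, huf, hfN, hlim⟩ := exists_continuous_tendsto_of_upperSemicontinuousOn
    ⟨_, circleMap_mem_sphere c hR.le 0⟩ (husc.mono hsub) h0 hN
  have h1 : ∀ n, u c ≤ Real.circleAverage (f n) c R := by
    intro n
    refine le_of_forall_pos_le_add fun ε hε => ?_
    obtain ⟨F, hF, hFf⟩ := exists_entire_re_near (hfc n) c hR (half_pos hε)
    have h2 := le_re_of_le_on_sphere husc h0 hN hloc hR hball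
      (F := fun z => F z + ((ε / 2 : ℝ) : ℂ)) (by fun_prop) (fun z hz => by
        have h3 := (abs_le.1 (hFf z hz)).2
        have := huf n z hz
        simp only [Complex.add_re, Complex.ofReal_re]
        linarith)
    have h3 : Real.circleAverage (fun z => (F z + ((-(ε / 2) : ℝ) : ℂ)).re) c R ≤
        Real.circleAverage (f n) c R := by
      refine Real.circleAverage_mono ?_ (hfc n).continuousOn.circleIntegrable' fun z hz => ?_
      · have := hF.continuous
        exact Continuous.continuousOn (by fun_prop) |>.circleIntegrable'
      · rw [abs_of_pos hR] at hz
        have h3 := (abs_le.1 (hFf z hz)).1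
        simp only [Complex.add_re, Complex.ofReal_re]
        linarith
    rw [circleAverage_re_of_differentiable (by fun_prop)] at h3
    simp only [Complex.add_re, Complex.ofReal_re] at h2 h3
    linarith
  have hlim' : Tendsto (fun n => Real.circleAverage (f n) c R) atTop
      (𝓝 (Real.circleAverage u c R)) := by
    refine Tendsto.const_smul ?_ _
    refine intervalIntegral.tendsto_integral_filter_of_dominated_convergence (fun _ => N)
      ?_ ?_ ?_ ?_
    · refine Eventually.of_forall fun n => Continuous.aestronglyMeasurable ?_
      have := hfc n
      fun_prop
    · refine Eventually.of_forall fun n => Eventually.of_forall fun θ _ => ?_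
      have hmem := circleMap_mem_sphere c hR.le θ
      rw [Real.norm_of_nonneg ((h0 _).trans (huf n _ hmem))]
      exact hfN n _ hmem
    · exact intervalIntegrable_const
    · exact Eventually.of_forall fun θ _ => hlim _ (circleMap_mem_sphere c hR.le θ)
  exact ge_of_tendsto' hlim' h1

/-! ### Averages over discs and radial weights -/

/-- A sub-mean value inequality on circles about `z` gives the one for every radial weight. -/
theorem ofReal_mul_lintegral_le_of_le_circleAverage {g : ℂ → ℝ} {N : ℝ} (hg : Measurable g)
    (h0 : ∀ z, 0 ≤ g z) (hN : ∀ z, g z ≤ N) {k : ℝ → ℝ≥0∞} (hk : Measurable k) {z : ℂ}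
    (hsub : ∀ r > 0, k r ≠ 0 → g z ≤ Real.circleAverage g z r) :
    ENNReal.ofReal (g z) * ∫⁻ ζ : ℂ, k ‖ζ‖ ≤ ∫⁻ ζ : ℂ, k ‖ζ‖ * ENNReal.ofReal (g (z + ζ)) := by
  rw [← lintegral_const_mul _ (by fun_prop)]
  rw [← Complex.lintegral_comp_polarCoord_symm, ← Complex.lintegral_comp_polarCoord_symm]
  rw [polarCoord_target, Measure.volume_eq_prod, ← Measure.prod_restrict]
  simp only [Complex.norm_polarCoord_symm]
  simp only [Complex.polarCoord_symm_apply, smul_eq_mul]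
  rw [lintegral_prod _ (by fun_prop), lintegral_prod _ (by fun_prop)]
  refine lintegral_mono_ae ((ae_restrict_iff' measurableSet_Ioi).2
    (Eventually.of_forall fun r hr => ?_))
  have hr : 0 < r := hr
  simp only [abs_of_pos hr]
  rw [lintegral_const_mul _ (by fun_prop), lintegral_const_mul _ (by fun_prop),
    lintegral_const_mul _ (by fun_prop)]
  gcongr
  by_cases hkr : k r = 0
  · simp [hkr]
  rw [lintegral_const, mul_comm (k r) (volume.restrict _ _), lintegral_const_mul _ (by fun_prop),
    ← mul_assoc, mul_comm _ (k r)]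
  gcongr
  have h1 := hsub r hr hkr
  have hmeas : Measurable fun θ : ℝ => g (circleMap z r θ) := by fun_prop
  have hint : ∀ a b : ℝ, IntegrableOn (fun θ : ℝ => g (circleMap z r θ)) (Ioc a b) := fun a b =>
    Measure.integrableOn_of_bounded (M := N) (by simp) hmeas.aestronglyMeasurable
      (Eventually.of_forall fun θ => by rw [Real.norm_of_nonneg (h0 _)]; exact hN _)
  have hper : Function.Periodic (fun θ : ℝ => g (circleMap z r θ)) (2 * Real.pi) := by
    intro θ
    simp only [(periodic_circleMap z r) θ]
  have h2 := hper.intervalIntegral_add_eq 0 (-Real.pi)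
  have h3 : -Real.pi + 2 * Real.pi = Real.pi := by ring
  rw [h3, zero_add, intervalIntegral.integral_of_le (by linarith [Real.pi_pos] :
    -Real.pi ≤ Real.pi)] at h2
  rw [Real.circleAverage_def, h2, smul_eq_mul] at h1
  have h4 : g z * (2 * Real.pi) ≤ ∫ θ in Ioc (-Real.pi) Real.pi, g (circleMap z r θ) := by
    have := mul_le_mul_of_nonneg_left h1 Real.two_pi_pos.le
    rw [mul_inv_cancel_left₀ Real.two_pi_pos.ne'] at this
    linarith
  have h5 := ENNReal.ofReal_le_ofReal h4
  rw [ofReal_integral_eq_lintegral_ofReal (hint _ _) (Eventually.of_forall fun θ => h0 _),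
    ENNReal.ofReal_mul (h0 _)] at h5
  refine le_trans (le_of_eq ?_) (h5.trans (le_of_eq ?_))
  · rw [Measure.restrict_apply MeasurableSet.univ, univ_inter, Real.volume_Ioo]
    congr 2; ring
  · rw [restrict_Ioo_eq_restrict_Ioc]
    refine lintegral_congr fun θ => ?_
    rw [circleMap, Complex.exp_mul_I, Complex.ofReal_cos, Complex.ofReal_sin]

theorem volume_ball_mul_le_lintegral {g : ℂ → ℝ} {N : ℝ} (hg : Measurable g)
    (h0 : ∀ z, 0 ≤ g z) (hN : ∀ z, g z ≤ N) {z : ℂ} {R : ℝ}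
    (hsub : ∀ r > 0, r < R → g z ≤ Real.circleAverage g z r) :
    ENNReal.ofReal (g z) * volume (Metric.ball z R) ≤
      ∫⁻ w in Metric.ball z R, ENNReal.ofReal (g w) := by
  have h := ofReal_mul_lintegral_le_of_le_circleAverage hg h0 hN (z := z)
    (k := (Iio R).indicator 1) (measurable_one.indicator measurableSet_Iio) (fun r hr hk =>
      hsub r hr (by by_contra h; exact hk (indicator_of_notMem (s := Iio R) h _)))
  have h1 : ∀ ζ : ℂ, (Iio R).indicator (1 : ℝ → ℝ≥0∞) ‖ζ‖ =
      (Metric.ball z R).indicator 1 (z + ζ) := by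
    intro ζ
    by_cases hζ : ‖ζ‖ < R <;> simp [indicator, hζ]
  simp only [h1] at h
  rw [lintegral_add_left_eq_self (fun w => (Metric.ball z R).indicator (1 : ℂ → ℝ≥0∞) w) z,
    lintegral_add_left_eq_self (fun w => (Metric.ball z R).indicator (1 : ℂ → ℝ≥0∞) w *
      ENNReal.ofReal (g w)) z, lintegral_indicator_one measurableSet_ball] at h
  rw [← lintegral_indicator measurableSet_ball]
  refine h.trans_eq (lintegral_congr fun w => ?_)
  by_cases hw : w ∈ Metric.ball z R <;> simp [hw]

theorem volume_ball_mul_le_volume {g : ℂ → ℝ} (hg : Measurable g)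
    (h0 : ∀ z, 0 ≤ g z) (hN : ∀ z, g z ≤ 1) {Ω : Set ℂ} (hΩ : ∀ z, z ∉ Ω → g z = 0) {z : ℂ} {R : ℝ}
    (hsub : ∀ r > 0, r < R → g z ≤ Real.circleAverage g z r) :
    ENNReal.ofReal (g z) * volume (Metric.ball z R) ≤ volume (Ω ∩ Metric.ball z R) := by
  refine (volume_ball_mul_le_lintegral hg h0 hN hsub).trans ?_
  rw [← Measure.restrict_apply' measurableSet_ball]
  refine (lintegral_mono (g := Ω.indicator 1) fun w => ?_).trans
    (lintegral_indicator_one_le _)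
  by_cases hw : w ∈ Ω
  · simp [hw, hN w]
  · simp [hw, hΩ w hw]

/-! ### Extension by zero of a truncated subharmonic function -/

theorem volume_eq_lintegral_crossSection {S : Set ℂ} (hS : MeasurableSet S) :
    volume S = ∫⁻ x, volume (crossSection S x) := by
  rw [← (Complex.volume_preserving_equiv_real_prod.symm).measure_preimage hS.nullMeasurableSet,
    Measure.volume_eq_prod, Measure.prod_apply (Complex.measurableEquivRealProd.symm.measurable hS)]
  rfl

theorem volume_inter_strip_le {Ω : Set ℂ} (hΩ : IsOpen Ω) {M : ℝ≥0}
    (hM : ∀ x : ℝ, volume (crossSection Ω x) ≤ (M : ℝ≥0∞)) (x₁ x₂ : ℝ) :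
    volume (Ω ∩ Complex.re ⁻¹' Icc x₁ x₂) ≤ M * ENNReal.ofReal (x₂ - x₁) := by
  rw [volume_eq_lintegral_crossSection (hΩ.measurableSet.inter
    (measurableSet_Icc.preimage Complex.measurable_re))]
  calc ∫⁻ x, volume (crossSection (Ω ∩ Complex.re ⁻¹' Icc x₁ x₂) x)
      ≤ ∫⁻ x, (Icc x₁ x₂).indicator (fun _ => (M : ℝ≥0∞)) x := by
        refine lintegral_mono fun x => ?_
        by_cases hx : x ∈ Icc x₁ x₂
        · rw [indicator_of_mem hx]
          exact (measure_mono fun y hy => hy.1).trans (hM x)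
        · rw [indicator_of_notMem hx]
          have : crossSection (Ω ∩ Complex.re ⁻¹' Icc x₁ x₂) x = ∅ :=
            eq_empty_of_forall_notMem fun y hy => hx hy.2
          simp [this]
    _ = _ := by rw [lintegral_indicator_const measurableSet_Icc, Real.volume_Icc]

/-- The function `max (v - c) 0` on `Ω`, extended by zero to the whole plane. -/
noncomputable def excess (Ω : Set ℂ) (v : ℂ → ℝ) (c : ℝ) : ℂ → ℝ :=
  Ω.indicator fun z => max (v z - c) 0

theorem excess_nonneg (Ω : Set ℂ) (v : ℂ → ℝ) (c : ℝ) (z : ℂ) : 0 ≤ excess Ω v c z :=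
  indicator_nonneg (fun _ _ => le_max_right _ _) _

theorem excess_of_notMem {Ω : Set ℂ} {z : ℂ} (v : ℂ → ℝ) (c : ℝ) (hz : z ∉ Ω) :
    excess Ω v c z = 0 := indicator_of_notMem hz _

theorem excess_of_mem {Ω : Set ℂ} {z : ℂ} (v : ℂ → ℝ) (c : ℝ) (hz : z ∈ Ω) :
    excess Ω v c z = max (v z - c) 0 := indicator_of_mem hz _

theorem measurable_excess {Ω : Set ℂ} (hΩ : IsOpen Ω) {v : ℂ → ℝ}
    (hv : UpperSemicontinuousOn v Ω) (c : ℝ) : Measurable (excess Ω v c) := by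
  have h1 : Measurable (Ω.domRestrict v) :=
    UpperSemicontinuous.measurable fun z y hy =>
      (tendsto_nhdsWithin_iff.2 ⟨continuous_subtype_val.continuousAt,
        Eventually.of_forall fun x => x.2⟩).eventually (hv z z.2 y hy)
  refine measurable_of_restrict_of_restrict_compl hΩ.measurableSet ?_ ?_
  · have h2 : Ω.domRestrict (excess Ω v c) = fun z => max (Ω.domRestrict v z - c) 0 := by
      ext z
      exact excess_of_mem v c z.2
    rw [h2]
    fun_prop
  · have h2 : Ωᶜ.domRestrict (excess Ω v c) = fun _ => 0 := by
      ext z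
      exact excess_of_notMem v c z.2
    rw [h2]
    fun_prop

theorem upperSemicontinuousOn_excess {Ω U : Set ℂ} (hΩ : IsOpen Ω) {v : ℂ → ℝ}
    (hv : UpperSemicontinuousOn v Ω) {c : ℝ}
    (hlim : ∀ ζ ∈ frontier Ω ∩ U, ∀ ε > 0, ∀ᶠ z in 𝓝[Ω] ζ, v z < c + ε) :
    UpperSemicontinuousOn (excess Ω v c) U := by
  intro z hz
  suffices h : UpperSemicontinuousAt (excess Ω v c) z from h.upperSemicontinuousWithinAt U
  intro y hy
  have hy0 : 0 < y := (excess_nonneg Ω v c z).trans_lt hy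
  by_cases hzΩ : z ∈ Ω
  · rw [excess_of_mem v c hzΩ, max_lt_iff] at hy
    have h1 := hv z hzΩ (y + c) (by linarith)
    rw [hΩ.nhdsWithin_eq hzΩ] at h1
    filter_upwards [h1] with w hw
    by_cases hwΩ : w ∈ Ω
    · rw [excess_of_mem v c hwΩ]
      exact max_lt (by linarith) hy0
    · rwa [excess_of_notMem v c hwΩ]
  by_cases hzc : z ∈ closure Ω
  · have h1 := hlim z ⟨⟨hzc, by rwa [hΩ.interior_eq]⟩, hz⟩ y hy0
    filter_upwards [eventually_nhdsWithin_iff.1 h1] with w hw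
    by_cases hwΩ : w ∈ Ω
    · rw [excess_of_mem v c hwΩ]
      exact max_lt (by linarith [hw hwΩ]) hy0
    · rwa [excess_of_notMem v c hwΩ]
  · filter_upwards [isClosed_closure.isOpen_compl.mem_nhds hzc] with w hw
    rwa [excess_of_notMem v c fun h => hw (subset_closure h)]

/-- In `Ω` this is the subharmonicity of `v`; elsewhere the left side is zero. -/
theorem excess_le_circleAverage_of_small {Ω : Set ℂ} (hΩ : IsOpen Ω) {v : ℂ → ℝ}
    (hv : SubharmonicOn v Ω) (c : ℝ) (z : ℂ) :
    ∀ᶠ r in 𝓝[>] (0 : ℝ), excess Ω v c z ≤ Real.circleAverage (excess Ω v c) z r := by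
  by_cases hz : z ∈ Ω
  · obtain ⟨ρ, hρ, hρΩ⟩ := Metric.nhds_basis_closedBall.mem_iff.1 (hΩ.mem_nhds hz)
    filter_upwards [Ioo_mem_nhdsGT hρ] with r hr
    have hsub : Metric.closedBall z r ⊆ Ω := (Metric.closedBall_subset_closedBall hr.2.le).trans hρΩ
    have hint := hv.circleIntegrable z r hr.1 hsub
    have hle := hv.le_circleAverage z r hr.1 hsub
    rw [excess_of_mem v c hz]
    refine max_le ?_ (Real.circleAverage_nonneg_of_nonneg fun w _ => excess_nonneg Ω v c w)
    have heq : EqOn (excess Ω v c) (fun w => max (v w - c) 0) (Metric.sphere z |r|) := by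
      intro w hw
      rw [abs_of_pos hr.1] at hw
      exact excess_of_mem v c (hsub (Metric.sphere_subset_closedBall hw))
    have hint1 : CircleIntegrable (fun w => v w - c) z r := hint.sub (circleIntegrable_const c z r)
    have hint2 : CircleIntegrable (fun w => max (v w - c) 0) z r := by
      refine intervalIntegrable_iff.2 ?_
      exact Integrable.sup (intervalIntegrable_iff.1 hint1)
        (intervalIntegrable_iff.1 (circleIntegrable_const (0 : ℝ) z r))
    rw [Real.circleAverage_congr_sphere heq]
    calc v z - c ≤ Real.circleAverage v z r - Real.circleAverage (fun _ => c) z r := by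
          rw [Real.circleAverage_const]; linarith
      _ = Real.circleAverage (fun w => v w - c) z r :=
          (Real.circleAverage_fun_sub hint (circleIntegrable_const c z r)).symm
      _ ≤ _ := Real.circleAverage_mono hint1 hint2 fun w _ => le_max_left _ _
  · refine Eventually.of_forall fun r => ?_
    rw [excess_of_notMem v c hz]
    exact Real.circleAverage_nonneg_of_nonneg fun w _ => excess_nonneg Ω v c w

/-- The sub-mean value inequality on all discs of a set on which the boundary values of `v` are at
most `c`, including the discs that cross the boundary of `Ω`. -/
theorem excess_le_circleAverage {Ω U : Set ℂ} (hΩ : IsOpen Ω) {v : ℂ → ℝ}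
    (hv : SubharmonicOn v Ω) (hbdd : BddAbove (v '' Ω)) {c : ℝ}
    (hlim : ∀ ζ ∈ frontier Ω ∩ U, ∀ ε > 0, ∀ᶠ z in 𝓝[Ω] ζ, v z < c + ε)
    {z : ℂ} {r : ℝ} (hr : 0 < r) (hball : Metric.closedBall z r ⊆ U) :
    excess Ω v c z ≤ Real.circleAverage (excess Ω v c) z r := by
  obtain ⟨N, hN⟩ := hbdd
  refine le_circleAverage_of_eventually (N := max (N - c) 0)
    (upperSemicontinuousOn_excess hΩ hv.usc hlim) (excess_nonneg Ω v c) (fun w => ?_)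
    (fun w _ => excess_le_circleAverage_of_small hΩ hv c w) hr hball
  by_cases hw : w ∈ Ω
  · rw [excess_of_mem v c hw]
    exact max_le_max_right _ (by linarith [hN (mem_image_of_mem v hw)])
  · rw [excess_of_notMem v c hw]
    exact le_max_right _ _

/-- Discs of radius `R` meet a domain with cross-sections of length at most `M` in area at most
`2RM`, a small proportion of the disc when `R` is large. -/
theorem le_of_le_circleAverage_of_crossSection {Ω : Set ℂ} (hΩ : IsOpen Ω) {M : ℝ≥0}
    (hM : ∀ x : ℝ, volume (crossSection Ω x) ≤ (M : ℝ≥0∞)) {g : ℂ → ℝ} {N : ℝ} (hNpos : 0 ≤ N)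
    (hg : Measurable g)
    (h0 : ∀ z, 0 ≤ g z) (hN : ∀ z, g z ≤ N) (hgΩ : ∀ z, z ∉ Ω → g z = 0) {z : ℂ} {R : ℝ}
    (hR : 0 < R) (hsub : ∀ r > 0, r < R → g z ≤ Real.circleAverage g z r) :
    g z ≤ 2 * N * M / (Real.pi * R) := by
  have h1 := volume_ball_mul_le_lintegral hg h0 hN hsub
  have h2 : ∫⁻ w in Metric.ball z R, ENNReal.ofReal (g w) ≤
      ENNReal.ofReal N * (M * ENNReal.ofReal (z.re + R - (z.re - R))) := by
    refine le_trans ?_ (mul_le_mul_right (volume_inter_strip_le hΩ hM _ _) _)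
    rw [← setLIntegral_const, ← lintegral_indicator measurableSet_ball,
      ← lintegral_indicator (hΩ.measurableSet.inter
        (measurableSet_Icc.preimage Complex.measurable_re))]
    refine lintegral_mono fun w => ?_
    by_cases hw : w ∈ Metric.ball z R
    · by_cases hwΩ : w ∈ Ω
      · rw [indicator_of_mem hw, indicator_of_mem]
        · exact ENNReal.ofReal_le_ofReal (hN w)
        · have h3 := (Complex.abs_re_le_norm (w - z)).trans_lt (mem_ball_iff_norm.1 hw)
          rw [Complex.sub_re, abs_lt] at h3
          exact ⟨hwΩ, by constructor <;> linarith⟩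
      · simp [hw, hgΩ w hwΩ]
    · rw [indicator_of_notMem hw]; exact zero_le
  have h3 := h1.trans h2
  rw [Complex.volume_ball] at h3
  have h4 : ENNReal.ofReal (g z * (R ^ 2 * Real.pi)) ≤ ENNReal.ofReal (N * (M * (2 * R))) := by
    refine le_trans (le_of_eq ?_) (h3.trans (le_of_eq ?_))
    · rw [ENNReal.ofReal_mul (h0 z), ENNReal.ofReal_mul (by positivity), ENNReal.ofReal_pow hR.le]
      congr 2
      rw [ENNReal.ofReal, Real.toNNReal_of_nonneg Real.pi_pos.le]; rfl
    · rw [ENNReal.ofReal_mul hNpos, ENNReal.ofReal_mul M.coe_nonneg, ENNReal.ofReal_coe_nnreal]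
      congr 3; ring
  rw [ENNReal.ofReal_le_ofReal_iff (by positivity)] at h4
  rw [le_div_iff₀ (by positivity)]
  nlinarith

/-! ### Boundedness and decay of the Perron family -/

theorem excess_le_iff {Ω : Set ℂ} {v : ℂ → ℝ} {c N : ℝ} (hN : 0 ≤ N) :
    (∀ z, excess Ω v c z ≤ N) ↔ ∀ z ∈ Ω, v z ≤ c + N := by
  constructor
  · intro h z hz
    have := h z
    rw [excess_of_mem v c hz] at this
    linarith [le_max_left (v z - c) 0]
  · intro h z
    by_cases hz : z ∈ Ω
    · rw [excess_of_mem v c hz]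
      exact max_le (by linarith [h z hz]) hN
    · rwa [excess_of_notMem v c hz]

/-- The maximum principle on a domain with cross-sections of bounded length: no condition at
infinity is needed, because a bounded subharmonic function on the plane vanishes when it is
supported in such a domain. -/
theorem le_of_limsup_le {Ω : Set ℂ} (hΩ : IsOpen Ω) {M : ℝ≥0}
    (hM : ∀ x : ℝ, volume (crossSection Ω x) ≤ (M : ℝ≥0∞)) {v : ℂ → ℝ} (hv : SubharmonicOn v Ω)
    (hbdd : BddAbove (v '' Ω)) {c : ℝ}
    (hlim : ∀ ζ ∈ frontier Ω, ∀ ε > 0, ∀ᶠ z in 𝓝[Ω] ζ, v z < c + ε) {z : ℂ} (hz : z ∈ Ω) :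
    v z ≤ c := by
  obtain ⟨N, hN⟩ := hbdd
  have hN' : ∀ w, excess Ω v c w ≤ |N - c| := (excess_le_iff (abs_nonneg _)).2 fun w hw => by
    linarith [hN (mem_image_of_mem v hw), le_abs_self (N - c)]
  have h1 : ∀ R > 0, excess Ω v c z ≤ 2 * |N - c| * M / (Real.pi * R) := fun R hR =>
    le_of_le_circleAverage_of_crossSection hΩ hM (abs_nonneg _) (measurable_excess hΩ hv.usc c)
      (excess_nonneg Ω v c) hN' (fun w hw => excess_of_notMem v c hw) hR fun r hr _ =>
        excess_le_circleAverage (U := univ) hΩ hv ⟨N, hN⟩ (fun ζ hζ => hlim ζ hζ.1) hr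
          (subset_univ _)
  have h2 : Tendsto (fun R : ℝ => 2 * |N - c| * M / (Real.pi * R)) atTop (𝓝 0) :=
    tendsto_const_nhds.div_atTop (tendsto_id.const_mul_atTop Real.pi_pos)
  have h3 : excess Ω v c z ≤ 0 := ge_of_tendsto h2 ((eventually_gt_atTop 0).mono h1)
  rw [excess_of_mem v c hz] at h3
  linarith [le_max_left (v z - c) 0]

section PerronFamily

variable {Ω : Set ℂ} {M : ℝ≥0} {v : ℂ → ℝ} {b : ℝ}

theorem PerronFamily.le_one (hΩ : IsOpen Ω)
    (hM : ∀ x : ℝ, volume (crossSection Ω x) ≤ (M : ℝ≥0∞))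
    (hv : PerronFamily Ω ((boundaryBeyond Ω b).indicator 1) v) (z : ℂ) : excess Ω v 0 z ≤ 1 := by
  refine (excess_le_iff zero_le_one).2 (fun w hw => ?_) z
  rw [zero_add]
  refine le_of_limsup_le hΩ hM hv.subharmonicOn hv.bddAbove (fun ζ hζ ε hε => ?_) hw
  refine (hv.limsup_le ζ hζ ε hε).mono fun y hy => hy.trans_le ?_
  gcongr
  exact indicator_le_self' (fun _ _ => zero_le_one) ζ

theorem PerronFamily.limsup_le_zero (hv : PerronFamily Ω ((boundaryBeyond Ω b).indicator 1) v) :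
    ∀ ζ ∈ frontier Ω ∩ {z | z.re < b}, ∀ ε > 0, ∀ᶠ z in 𝓝[Ω] ζ, v z < 0 + ε := by
  intro ζ hζ ε hε
  have h := hv.limsup_le ζ hζ.1 ε hε
  rwa [indicator_of_notMem fun h : ζ ∈ boundaryBeyond Ω b =>
    absurd (show ζ.re < b from hζ.2) (not_lt.2 h.2)] at h

theorem PerronFamily.excess_le_circleAverage (hΩ : IsOpen Ω)
    (hv : PerronFamily Ω ((boundaryBeyond Ω b).indicator 1) v) {z : ℂ} {r : ℝ} (hr : 0 < r)
    (hz : z.re + r < b) :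
    excess Ω v 0 z ≤ Real.circleAverage (excess Ω v 0) z r := by
  refine Carleman.excess_le_circleAverage hΩ hv.subharmonicOn hv.bddAbove hv.limsup_le_zero hr
    fun w hw => ?_
  have h1 := (Complex.abs_re_le_norm (w - z)).trans (mem_closedBall_iff_norm.1 hw)
  rw [Complex.sub_re, abs_le] at h1
  change w.re < b
  linarith

theorem PerronFamily.isClosed_superlevel (hΩ : IsOpen Ω)
    (hv : PerronFamily Ω ((boundaryBeyond Ω b).indicator 1) v) {b' δ : ℝ} (hb' : b' < b) :
    IsClosed {z : ℂ | z.re ≤ b' ∧ δ ≤ excess Ω v 0 z} := by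
  rw [← isOpen_compl_iff, isOpen_iff_mem_nhds]
  intro z hz
  have hre : IsOpen {z : ℂ | z.re < b} := isOpen_lt Complex.continuous_re continuous_const
  by_cases h : z.re ≤ b'
  · have h1 : excess Ω v 0 z < δ := by
      by_contra! hle
      exact hz ⟨h, hle⟩
    have h2 := upperSemicontinuousOn_excess hΩ hv.subharmonicOn.usc hv.limsup_le_zero z
      (h.trans_lt hb') δ h1
    rw [hre.nhdsWithin_eq (h.trans_lt hb')] at h2
    exact h2.mono fun w hw hw' => absurd hw (not_lt.2 hw'.2)
  · filter_upwards [(isOpen_lt continuous_const Complex.continuous_re).mem_nhds (not_le.1 h)]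
      with w hw hw'
    exact absurd hw'.1 (not_le.2 hw)

/-- The area of the part of `Ω` in a vertical strip is finite, so the discs about distant points
carry little of it, and a subharmonic function supported in `Ω` tends to zero at infinity. -/
theorem PerronFamily.isCompact_superlevel (hΩ : IsOpen Ω)
    (hM : ∀ x : ℝ, volume (crossSection Ω x) ≤ (M : ℝ≥0∞))
    (hv : PerronFamily Ω ((boundaryBeyond Ω b).indicator 1) v) {b' δ : ℝ} (hb' : b' < b)
    (hδ : 0 < δ) : IsCompact {z : ℂ | z.re ≤ b' ∧ δ ≤ excess Ω v 0 z} := by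
  have hmeas := measurable_excess hΩ hv.subharmonicOn.usc 0
  -- discs of radius `b - Re z` about `z` show that `u < δ` to the left of `X`
  set X := b - 2 * M / (Real.pi * δ) with hX
  have hleft : ∀ z : ℂ, z.re ≤ b' → δ ≤ excess Ω v 0 z → X ≤ z.re := by
    intro z hz hzδ
    have hpos : 0 < b - z.re := by linarith
    have h1 := le_of_le_circleAverage_of_crossSection hΩ hM zero_le_one hmeas
      (excess_nonneg Ω v 0) (hv.le_one hΩ hM) (fun w hw => excess_of_notMem v 0 hw) hpos
      fun r hr hrb => hv.excess_le_circleAverage (z := z) hΩ hr (by linarith)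
    have h2 := hzδ.trans h1
    rw [le_div_iff₀ (by positivity)] at h2
    have : b - z.re ≤ 2 * M / (Real.pi * δ) := by
      rw [le_div_iff₀ (by positivity)]
      nlinarith
    linarith
  set R := (b - b') / 2 with hR
  have hRpos : 0 < R := by rw [hR]; linarith
  have hSmeas : MeasurableSet (Ω ∩ Complex.re ⁻¹' Icc (X - R) b) :=
    hΩ.measurableSet.inter (measurableSet_Icc.preimage Complex.measurable_re)
  have hSfin : volume (Ω ∩ Complex.re ⁻¹' Icc (X - R) b) ≠ ⊤ :=
    ne_top_of_le_ne_top (by finiteness) (volume_inter_strip_le hΩ hM (X - R) b)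
  set T : ℕ → Set ℂ := fun n => (Ω ∩ Complex.re ⁻¹' Icc (X - R) b) ∩ {z | (n : ℝ) ≤ |z.im|} with hT
  have hTmeas : ∀ n, MeasurableSet (T n) := fun n =>
    hSmeas.inter (measurableSet_le measurable_const (by fun_prop))
  have hlim : Tendsto (fun n => volume (T n)) atTop (𝓝 0) := by
    have h1 := tendsto_measure_iInter_atTop (μ := volume) (s := T)
      (fun n => (hTmeas n).nullMeasurableSet)
      (fun m n hmn z hz =>
        ⟨hz.1, show (m : ℝ) ≤ |z.im| from le_trans (by exact_mod_cast hmn) hz.2⟩)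
      ⟨0, ne_top_of_le_ne_top hSfin (measure_mono inter_subset_left)⟩
    have h2 : ⋂ n, T n = ∅ := by
      refine eq_empty_of_forall_notMem fun z hz => ?_
      obtain ⟨n, hn⟩ := exists_nat_gt |z.im|
      exact absurd (mem_iInter.1 hz n).2 (not_le.2 hn)
    rwa [h2, measure_empty] at h1
  have hpos : 0 < ENNReal.ofReal δ * volume (Metric.ball (0 : ℂ) R) :=
    ENNReal.mul_pos (by simpa using hδ) (Metric.measure_ball_pos _ _ hRpos).ne'
  obtain ⟨n, hn⟩ := (hlim.eventually_lt_const hpos).exists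
  refine Metric.isCompact_of_isClosed_isBounded (hv.isClosed_superlevel hΩ hb') ?_
  refine ((Metric.isBounded_Icc X b').reProdIm (Metric.isBounded_Icc (-(n + R)) (n + R))).subset
    fun z hz => ?_
  have hzX := hleft z hz.1 hz.2
  refine ⟨⟨hzX, hz.1⟩, abs_le.1 ?_⟩
  by_contra! him
  have h1 := volume_ball_mul_le_volume hmeas (excess_nonneg Ω v 0) (hv.le_one hΩ hM)
    (fun w hw => excess_of_notMem v 0 hw) (z := z) (R := R)
    fun r hr hrR => hv.excess_le_circleAverage (z := z) hΩ hr (by linarith [hz.1])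
  have h2 : Ω ∩ Metric.ball z R ⊆ T n := by
    intro w hw
    have h3 := (Complex.abs_re_le_norm (w - z)).trans_lt (mem_ball_iff_norm.1 hw.2)
    have h4 := (Complex.abs_im_le_norm (w - z)).trans_lt (mem_ball_iff_norm.1 hw.2)
    rw [Complex.sub_re, abs_lt] at h3
    rw [Complex.sub_im] at h4
    refine ⟨⟨hw.1, ?_, ?_⟩, ?_⟩
    · linarith
    · linarith [hz.1]
    · have := abs_sub_abs_le_abs_sub z.im w.im
      rw [abs_sub_comm] at this
      change (n : ℝ) ≤ |w.im|
      linarith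
  have h3 : ENNReal.ofReal δ * volume (Metric.ball (0 : ℂ) R) ≤ volume (T n) := by
    refine le_trans ?_ (h1.trans (measure_mono h2))
    rw [Measure.addHaar_ball_center volume z R]
    gcongr
    exact hz.2
  exact absurd hn (not_lt.2 h3)

end PerronFamily

/-! ### Mollification by a radial kernel -/

/-- A radial mollifier; it is smooth at the origin because it is a smooth function of `‖ζ‖ ^ 2`. -/
theorem exists_radial_mollifier {ε : ℝ} (hε : 0 < ε) :
    ∃ k : ℝ → ℝ, Continuous k ∧ (∀ r, 0 ≤ k r) ∧ (∀ r, ε ≤ r → k r = 0) ∧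
      ContDiff ℝ ∞ (fun ζ : ℂ => k ‖ζ‖) ∧ ∫ ζ : ℂ, k ‖ζ‖ = 1 := by
  set f : ℝ → ℝ := fun r => Real.smoothTransition (1 - r ^ 2 / ε ^ 2) with hf
  have hfc : Continuous f := by
    have := Real.smoothTransition.continuous
    fun_prop
  have hf0 : ∀ r, 0 ≤ f r := fun r => Real.smoothTransition.nonneg _
  have hfz : ∀ r, ε ≤ r → f r = 0 := by
    intro r hr
    refine Real.smoothTransition.zero_of_nonpos ?_
    rw [sub_nonpos, one_le_div (by positivity)]
    gcongr
  have hsmooth : ContDiff ℝ ∞ (fun ζ : ℂ => f ‖ζ‖) := by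
    refine Real.smoothTransition.contDiff.comp ?_
    exact contDiff_const.sub ((contDiff_norm_sq ℝ).div_const _)
  have hcpt : HasCompactSupport (fun ζ : ℂ => f ‖ζ‖) := by
    refine HasCompactSupport.of_support_subset_isCompact (isCompact_closedBall (0 : ℂ) ε) ?_
    intro ζ hζ
    rw [mem_closedBall_zero_iff]
    by_contra! h
    exact hζ (hfz _ h.le)
  have hpos : 0 < ∫ ζ : ℂ, f ‖ζ‖ := by
    refine hsmooth.continuous.integral_pos_of_hasCompactSupport_nonneg_nonzero hcpt
      (fun ζ => hf0 _) (x := 0) ?_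
    simp [hf]
  refine ⟨fun r => f r / ∫ ζ : ℂ, f ‖ζ‖, hfc.div_const _, fun r => div_nonneg (hf0 r) hpos.le,
    fun r hr => by simp only [hfz r hr, zero_div], hsmooth.div_const _, ?_⟩
  rw [integral_div, div_self hpos.ne']

/-- Convolution with a radial kernel preserves the sub-mean value inequality and does not decrease
the function. -/
theorem exists_smooth_approx {g : ℂ → ℝ} (hg : Measurable g) (h0 : ∀ z, 0 ≤ g z)
    (h1 : ∀ z, g z ≤ 1) {K : Set ℂ} (hgK : ∀ z, z ∉ K → g z = 0) {β : ℝ}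
    (hsub : ∀ z r, 0 < r → z.re + r ≤ β → g z ≤ Real.circleAverage g z r) {ε : ℝ} (hε : 0 < ε) :
    ∃ w : ℂ → ℝ, ContDiff ℝ ∞ w ∧ (∀ z, 0 ≤ w z) ∧ (∀ z, w z ≤ 1) ∧
      (∀ z, z ∉ Metric.thickening ε K → w z = 0) ∧
      (∀ z r, 0 < r → z.re + r ≤ β - ε → w z ≤ Real.circleAverage w z r) ∧
      ∀ z : ℂ, z.re + ε ≤ β → g z ≤ w z := by
  obtain ⟨k, hkc, hk0, hkε, hksm, hkint⟩ := exists_radial_mollifier hε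
  have hki : Integrable (fun ζ : ℂ => k ‖ζ‖) := by
    by_contra h
    rw [integral_undef h] at hkint
    exact zero_ne_one hkint
  have hcpt : HasCompactSupport (fun ζ : ℂ => k ‖ζ‖) := by
    refine HasCompactSupport.of_support_subset_isCompact (isCompact_closedBall (0 : ℂ) ε) ?_
    intro ζ hζ
    rw [mem_closedBall_zero_iff]
    by_contra! h
    exact hζ (hkε _ h.le)
  have hint : ∀ z, Integrable (fun ζ : ℂ => k ‖ζ‖ * g (z - ζ)) := fun z =>
    hki.mono' (by fun_prop : Measurable _).aestronglyMeasurable (Eventually.of_forall fun ζ => by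
      rw [Real.norm_of_nonneg (mul_nonneg (hk0 _) (h0 _))]
      exact mul_le_of_le_one_right (hk0 _) (h1 _))
  have hloc : LocallyIntegrable g := by
    refine (locallyIntegrable_const (1 : ℝ)).mono hg.aestronglyMeasurable
      (Eventually.of_forall fun z => ?_)
    rw [Real.norm_of_nonneg (h0 z), norm_one]
    exact h1 z
  refine ⟨fun z => ∫ ζ : ℂ, k ‖ζ‖ * g (z - ζ), ?_, fun z => ?_, fun z => ?_, fun z hz => ?_,
    fun z r hr hz => ?_, fun z hz => ?_⟩
  · exact hcpt.contDiff_convolution_left (ContinuousLinearMap.lsmul ℝ ℝ) hksm hloc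
  · exact integral_nonneg fun ζ => mul_nonneg (hk0 _) (h0 _)
  · rw [← hkint]
    exact integral_mono (hint z) hki fun ζ => mul_le_of_le_one_right (hk0 _) (h1 _)
  · refine integral_eq_zero_of_ae (Eventually.of_forall fun ζ => ?_)
    simp only [Pi.zero_apply, mul_eq_zero]
    by_contra! h
    refine hz (Metric.mem_thickening_iff.2 ⟨z - ζ, ?_, ?_⟩)
    · by_contra hK
      exact h.2 (hgK _ hK)
    · rw [dist_eq_norm, sub_sub_cancel]
      by_contra! hle
      exact h.1 (hkε _ hle)
  · have : IsFiniteMeasure ((volume : Measure ℝ).restrict (uIoc 0 (2 * Real.pi))) :=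
      isFiniteMeasure_restrict.2 (by rw [uIoc_of_le Real.two_pi_pos.le]; simp [ENNReal.mul_eq_top])
    have hprod : Integrable
        (Function.uncurry fun (θ : ℝ) (ζ : ℂ) => k ‖ζ‖ * g (circleMap z r θ - ζ))
        ((volume.restrict (uIoc 0 (2 * Real.pi))).prod volume) := by
      refine (hki.comp_snd _).mono'
        (by unfold Function.uncurry; fun_prop : Measurable _).aestronglyMeasurable
        (Eventually.of_forall fun p => ?_)
      rw [Function.uncurry, Real.norm_of_nonneg (mul_nonneg (hk0 _) (h0 _))]
      exact mul_le_of_le_one_right (hk0 _) (h1 _)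
    rw [Real.circleAverage_def, intervalIntegral_integral_swap hprod, smul_eq_mul,
      ← integral_const_mul]
    refine integral_mono_of_nonneg (Eventually.of_forall fun ζ => mul_nonneg (hk0 _) (h0 _)) ?_
      (Eventually.of_forall fun ζ => ?_)
    · refine (hprod.integral_prod_right.const_mul (2 * Real.pi)⁻¹).congr
        (Eventually.of_forall fun ζ => ?_)
      simp only [Function.uncurry]
      rw [intervalIntegral.integral_of_le Real.two_pi_pos.le, uIoc_of_le Real.two_pi_pos.le]
    · simp only
      by_cases hζ : ε ≤ ‖ζ‖
      · simp [hkε _ hζ]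
      · have h2 := hsub (z - ζ) r hr (by
          have := Complex.abs_re_le_norm ζ
          rw [abs_le] at this
          rw [Complex.sub_re]
          linarith)
        rw [Real.circleAverage_def, smul_eq_mul] at h2
        rw [intervalIntegral.integral_const_mul, mul_left_comm]
        refine mul_le_mul_of_nonneg_left (h2.trans_eq ?_) (hk0 _)
        congr 2
        ext θ
        congr 1
        simp only [circleMap]; ring
  · have h2 := ofReal_mul_lintegral_le_of_le_circleAverage hg h0 h1 (z := z)
      (k := fun r => ENNReal.ofReal (k r)) (by fun_prop) (fun r hr hkr => hsub z r hr (by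
        by_contra! h
        refine hkr ?_
        rw [hkε r (by linarith), ENNReal.ofReal_zero]))
    rw [← ofReal_integral_eq_lintegral_ofReal hki (Eventually.of_forall fun ζ => hk0 _), hkint,
      ENNReal.ofReal_one, mul_one] at h2
    have h3 : ∫ ζ : ℂ, k ‖ζ‖ * g (z - ζ) = ∫ ζ : ℂ, k ‖ζ‖ * g (z + ζ) := by
      rw [← integral_neg_eq_self]
      simp only [norm_neg, sub_neg_eq_add]
    change _ ≤ ∫ ζ : ℂ, k ‖ζ‖ * g (z - ζ)
    rw [h3, ← ENNReal.ofReal_le_ofReal_iff (integral_nonneg fun ζ => mul_nonneg (hk0 _) (h0 _)),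
      ofReal_integral_eq_lintegral_ofReal ?_
        (Eventually.of_forall fun ζ => mul_nonneg (hk0 _) (h0 _))]
    · refine h2.trans_eq (lintegral_congr fun ζ => ?_)
      rw [ENNReal.ofReal_mul (hk0 _)]
    · have := (hint z).comp_neg
      simpa only [norm_neg, sub_neg_eq_add] using this

/-! ### The Laplacian of a smooth function with the sub-mean value property -/

theorem hasDerivAt_intervalIntegral_of_continuous {F F' : ℝ → ℝ → ℝ} (hF : ∀ x, Continuous (F x))
    (hF' : Continuous (Function.uncurry F')) (hd : ∀ x y, HasDerivAt (fun x => F x y) (F' x y) x)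
    (a b x : ℝ) :
    HasDerivAt (fun x => ∫ y in a..b, F x y) (∫ y in a..b, F' x y) x := by
  obtain ⟨C, hC⟩ := ((isCompact_closedBall x 1).prod (isCompact_uIcc (a := a) (b := b))
    ).exists_bound_of_continuousOn hF'.continuousOn
  refine (intervalIntegral.hasDerivAt_integral_of_dominated_loc_of_deriv_le (bound := fun _ => C)
    (Metric.ball_mem_nhds x one_pos)
    (Eventually.of_forall fun y => (hF y).aestronglyMeasurable) ((hF x).intervalIntegrable a b)
    (hF'.comp (by fun_prop : Continuous fun y : ℝ => (x, y))).aestronglyMeasurable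
    (Eventually.of_forall fun y hy x' hx' => ?_) intervalIntegrable_const
    (Eventually.of_forall fun y _ x' _ => hd x' y)).2
  exact hC (x', y) ⟨Metric.ball_subset_closedBall hx', uIoc_subset_uIcc hy⟩

/-- The derivative of a function on the plane in the direction `e`, as a function. -/
noncomputable def dirDeriv (e : ℂ) (f : ℂ → ℝ) : ℂ → ℝ := fun z => fderiv ℝ f z e

theorem contDiff_dirDeriv {f : ℂ → ℝ} (hf : ContDiff ℝ ∞ f) (e : ℂ) :
    ContDiff ℝ ∞ (dirDeriv e f) :=
  (hf.fderiv_right (m := ∞) (by norm_num)).clm_apply contDiff_const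

theorem dirDeriv_eq {f : ℂ → ℝ} (e z : ℂ) :
    dirDeriv e f z = e.re * dirDeriv 1 f z + e.im * dirDeriv Complex.I f z := by
  have h : e = e.re • (1 : ℂ) + e.im • Complex.I := by simp
  conv_lhs => rw [h]
  simp only [dirDeriv, map_add, map_smul, smul_eq_mul]

theorem hasDerivAt_comp_line {f : ℂ → ℝ} (hf : ContDiff ℝ ∞ f) (z e : ℂ) (t : ℝ) :
    HasDerivAt (fun t : ℝ => f (z + t * e)) (dirDeriv e f (z + t * e)) t := by
  have h1 : HasDerivAt (fun t : ℝ => z + t * e) e t := by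
    simpa using ((Complex.ofRealCLM.hasDerivAt (x := t)).mul_const e).const_add z
  exact ((hf.differentiable (by simp)) _).hasFDerivAt.comp_hasDerivAt t h1

/-- A smooth function with the sub-mean value property has nonnegative Laplacian: the second
derivative at `r = 0` of the mean of `w` over the circle of radius `r` about `z` is
half the Laplacian of `w` at `z`. -/
theorem laplacian_nonneg_of_le_circleAverage {w : ℂ → ℝ} (hw : ContDiff ℝ ∞ w) {z : ℂ} {ρ : ℝ}
    (hρ : 0 < ρ) (hsub : ∀ r, 0 < r → r < ρ → w z ≤ Real.circleAverage w z r) :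
    0 ≤ dirDeriv 1 (dirDeriv 1 w) z + dirDeriv Complex.I (dirDeriv Complex.I w) z := by
  set e : ℝ → ℂ := fun θ => Complex.exp (θ * Complex.I) with he
  have hec : Continuous e := by fun_prop
  have here : ∀ θ, (e θ).re = Real.cos θ := fun θ => Complex.exp_ofReal_mul_I_re θ
  have heim : ∀ θ, (e θ).im = Real.sin θ := fun θ => Complex.exp_ofReal_mul_I_im θ
  have hw1 := contDiff_dirDeriv hw 1
  have hwI := contDiff_dirDeriv hw Complex.I
  have hc1 := hw1.continuous
  have hcI := hwI.continuous
  have hc11 := (contDiff_dirDeriv hw1 1).continuous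
  have hc1I := (contDiff_dirDeriv hw1 Complex.I).continuous
  have hcI1 := (contDiff_dirDeriv hwI 1).continuous
  have hcII := (contDiff_dirDeriv hwI Complex.I).continuous
  set m : ℝ → ℝ := fun r => ∫ θ in (0)..(2 * Real.pi), w (z + r * e θ) with hm
  set m' : ℝ → ℝ := fun r => ∫ θ in (0)..(2 * Real.pi),
    (Real.cos θ * dirDeriv 1 w (z + r * e θ) + Real.sin θ * dirDeriv Complex.I w (z + r * e θ))
    with hm'
  have hd1 : ∀ r, HasDerivAt m (m' r) r := by
    intro r
    refine hasDerivAt_intervalIntegral_of_continuous (F := fun r θ => w (z + r * e θ))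
      (F' := fun r θ => Real.cos θ * dirDeriv 1 w (z + r * e θ) +
        Real.sin θ * dirDeriv Complex.I w (z + r * e θ)) (fun x => ?_) ?_ (fun r θ => ?_) _ _ _
    · have := hw.continuous
      fun_prop
    · unfold Function.uncurry
      fun_prop
    · convert hasDerivAt_comp_line hw z (e θ) r using 1
      rw [dirDeriv_eq (e θ), here, heim]
  have hd2 := hasDerivAt_intervalIntegral_of_continuous (F := fun r θ =>
    (Real.cos θ * dirDeriv 1 w (z + r * e θ) + Real.sin θ * dirDeriv Complex.I w (z + r * e θ)))
    (F' := fun r θ => Real.cos θ * dirDeriv (e θ) (dirDeriv 1 w) (z + r * e θ) +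
      Real.sin θ * dirDeriv (e θ) (dirDeriv Complex.I w) (z + r * e θ)) (fun r => by fun_prop)
    (by
      simp only [dirDeriv_eq (e _), here, heim]
      unfold Function.uncurry
      fun_prop)
    (fun r θ => ((hasDerivAt_comp_line hw1 z (e θ) r).const_mul _).add
      ((hasDerivAt_comp_line hwI z (e θ) r).const_mul _)) 0 (2 * Real.pi) 0
  have hm'0 : m' 0 = 0 := by
    simp only [hm', Complex.ofReal_zero, zero_mul, add_zero]
    rw [intervalIntegral.integral_add (Continuous.intervalIntegrable (by fun_prop) _ _)
      (Continuous.intervalIntegrable (by fun_prop) _ _)]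
    simp
  set a := dirDeriv 1 (dirDeriv 1 w) z
  set d := dirDeriv Complex.I (dirDeriv Complex.I w) z
  have hm'' : HasDerivAt m' (Real.pi * (a + d)) 0 := by
    convert hd2 using 1
    simp only [dirDeriv_eq (e _), here, heim, Complex.ofReal_zero, zero_mul, add_zero]
    set b := dirDeriv 1 (dirDeriv Complex.I w) z
    set c := dirDeriv Complex.I (dirDeriv 1 w) z
    have h1 : ∀ θ : ℝ, Real.cos θ * (Real.cos θ * a + Real.sin θ * c) +
        Real.sin θ * (Real.cos θ * b + Real.sin θ * d) =
        Real.cos θ ^ 2 * a + (Real.sin θ * Real.cos θ * (b + c) + Real.sin θ ^ 2 * d) := by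
      intro θ; ring
    change _ = ∫ θ in (0)..(2 * Real.pi), (Real.cos θ * (Real.cos θ * a + Real.sin θ * c) +
        Real.sin θ * (Real.cos θ * b + Real.sin θ * d))
    simp only [h1]
    rw [intervalIntegral.integral_add (Continuous.intervalIntegrable (by fun_prop) _ _)
      (Continuous.intervalIntegrable (by fun_prop) _ _),
      intervalIntegral.integral_add (Continuous.intervalIntegrable (by fun_prop) _ _)
      (Continuous.intervalIntegrable (by fun_prop) _ _)]
    simp only [intervalIntegral.integral_mul_const, integral_cos_sq, integral_sin_sq,
      integral_sin_mul_cos₁]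
    simp
    ring
  by_contra! hneg
  -- otherwise `m'` is negative, and `m` decreasing, to the right of `0`
  have h1 : ∀ᶠ r in 𝓝[>] (0 : ℝ), m' r < 0 := by
    have h2 := (hasDerivAt_iff_tendsto_slope.1 hm'').eventually_lt_const
      (mul_neg_of_pos_of_neg Real.pi_pos hneg)
    filter_upwards [h2.filter_mono (nhdsWithin_mono 0 fun r (hr : 0 < r) => hr.ne'),
      self_mem_nhdsWithin] with r hr hr0
    rw [slope_def_field, hm'0, sub_zero, sub_zero, div_neg_iff] at hr
    rcases hr with hr | hr
    · exact absurd hr.2 (not_lt.2 (le_of_lt hr0))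
    · exact hr.1
  obtain ⟨r₁, hr₁, hr₁'⟩ := mem_nhdsGT_iff_exists_Ioo_subset.1 h1
  set r := min (r₁ / 2) (ρ / 2)
  have hr₁0 : 0 < r₁ := hr₁
  have hr : 0 < r := by positivity
  have hrr₁ : r < r₁ := (min_le_left _ _).trans_lt (by linarith)
  have hrρ : r < ρ := (min_le_right _ _).trans_lt (by linarith)
  have hanti : StrictAntiOn m (Icc 0 r) := by
    refine strictAntiOn_of_deriv_neg (convex_Icc 0 r)
      (fun x _ => (hd1 x).continuousAt.continuousWithinAt) fun x hx => ?_
    rw [interior_Icc] at hx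
    rw [(hd1 x).deriv]
    exact hr₁' ⟨hx.1, hx.2.trans hrr₁⟩
  have h3 := hanti (left_mem_Icc.2 hr.le) (right_mem_Icc.2 hr.le) hr
  have h4 := hsub r hr hrρ
  have h5 : m 0 = 2 * Real.pi * w z := by simp [hm]
  rw [Real.circleAverage_def, smul_eq_mul] at h4
  have h6 := mul_le_mul_of_nonneg_left h4 Real.two_pi_pos.le
  rw [mul_inv_cancel_left₀ Real.two_pi_pos.ne', ← h5] at h6
  exact absurd h3 (not_lt.2 h6)

/-! ### Wirtinger's inequality -/

/-- **Wirtinger's inequality** on an open set whose intervals have length at most `L`. With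
`κ = π / L` and `a` the left endpoint of the component of `y`, the function
`p = κ cot (κ (y - a))` satisfies `p' = -κ² - p²`, so that
`f'² - κ² f² = (f' - p f)² + (p f²)'`, and the last term integrates to zero. -/
theorem wirtinger_inequality {U : Set ℝ} (hU : IsOpen U) {L : ℝ} (hL0 : 0 < L)
    (hL : ∀ a b, Ioo a b ⊆ U → b - a ≤ L) {f f' : ℝ → ℝ} (hf : ∀ y, HasDerivAt f (f' y) y)
    (hf'c : Continuous f') (hcpt : HasCompactSupport f) (hsupp : tsupport f ⊆ U) :
    (Real.pi / L) ^ 2 * ∫ y, f y ^ 2 ≤ ∫ y, f' y ^ 2 := by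
  have hfc : Continuous f := continuous_iff_continuousAt.2 fun y => (hf y).continuousAt
  have hf0 : ∀ y, y ∉ tsupport f → ∀ᶠ x in 𝓝 y, f x = 0 := fun y hy =>
    notMem_tsupport_iff_eventuallyEq.1 hy
  have hf'0 : ∀ y, y ∉ tsupport f → f' y = 0 := fun y hy =>
    (hf y).unique ((hasDerivAt_const y (0 : ℝ)).congr_of_eventuallyEq (hf0 y hy))
  set κ := Real.pi / L with hκ
  have hκ0 : 0 < κ := div_pos Real.pi_pos hL0
  set a : ℝ → ℝ := fun y => sSup (Uᶜ ∩ Iic y) with ha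
  have hne : ∀ y, (Uᶜ ∩ Iic y).Nonempty := by
    intro y
    by_contra h
    have h1 : Ioo (y - L - 1) y ⊆ U := by
      intro x hx
      by_contra hxU
      exact h ⟨x, hxU, hx.2.le⟩
    linarith [hL _ _ h1]
  have hbdd : ∀ y, BddAbove (Uᶜ ∩ Iic y) := fun y => ⟨y, fun x hx => hx.2⟩
  have hamem : ∀ y, a y ∈ Uᶜ ∩ Iic y := fun y =>
    (hU.isClosed_compl.inter isClosed_Iic).csSup_mem (hne y) (hbdd y)
  have hIoc : ∀ y, Ioc (a y) y ⊆ U := by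
    intro y x hx
    by_contra hxU
    exact absurd (le_csSup (hbdd y) ⟨hxU, hx.2⟩) (not_le.2 hx.1)
  have hay : ∀ y ∈ U, a y < y := fun y hy =>
    lt_of_le_of_ne (hamem y).2 fun h => (hamem y).1 (by rw [h]; exact hy)
  have haL : ∀ y ∈ U, y - a y < L := by
    intro y hy
    obtain ⟨η, hη, hηU⟩ := Metric.isOpen_iff.1 hU y hy
    have h1 : Ioo (a y) (y + η) ⊆ U := by
      intro x hx
      rcases le_or_gt x y with h | h
      · exact hIoc y ⟨hx.1, h⟩
      · refine hηU ?_
        rw [Metric.mem_ball, Real.dist_eq, abs_of_pos (by linarith)]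
        linarith [hx.2]
    linarith [hL _ _ h1]
  have haconst : ∀ y ∈ U, ∀ᶠ x in 𝓝 y, a x = a y := by
    intro y hy
    obtain ⟨η, hη, hηU⟩ := Metric.isOpen_iff.1 hU y hy
    filter_upwards [Metric.ball_mem_nhds y hη] with x hx
    rw [Metric.mem_ball, Real.dist_eq, abs_lt] at hx
    have h1 : ∀ t, t ∉ U → (t ≤ x ↔ t ≤ y) := by
      intro t ht
      by_contra! h
      refine ht (hηU ?_)
      rw [Metric.mem_ball, Real.dist_eq, abs_lt]
      rcases h with h | h <;> constructor <;> linarith [h.1, h.2]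
    have h2 : Uᶜ ∩ Iic x = Uᶜ ∩ Iic y := by
      ext t
      simp only [mem_inter_iff, mem_compl_iff, mem_Iic]
      exact and_congr_right fun ht => h1 t ht
    simp only [ha, h2]
  set p : ℝ → ℝ := fun y => κ * Real.cos (κ * (y - a y)) / Real.sin (κ * (y - a y)) with hp
  have hpd : ∀ y ∈ U, HasDerivAt p (-κ ^ 2 - p y ^ 2) y := by
    intro y hy
    have hsin : Real.sin (κ * (y - a y)) ≠ 0 := by
      refine (Real.sin_pos_of_pos_of_lt_pi (mul_pos hκ0 (sub_pos.2 (hay y hy))) ?_).ne'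
      calc κ * (y - a y) < κ * L := by gcongr; exact haL y hy
        _ = Real.pi := by rw [hκ]; field_simp
    have h1 : HasDerivAt (fun x => κ * (x - a y)) κ y := by
      simpa using ((hasDerivAt_id y).sub_const (a y)).const_mul κ
    have h2 := (h1.cos.const_mul κ).div h1.sin hsin
    have h3 : p =ᶠ[𝓝 y] fun x => κ * Real.cos (κ * (x - a y)) / Real.sin (κ * (x - a y)) := by
      filter_upwards [haconst y hy] with x hx
      simp only [hp, hx]
    refine (h2.congr_of_eventuallyEq h3).congr_deriv ?_
    simp only [hp]
    field_simp
  set G' : ℝ → ℝ := fun y => f' y ^ 2 - κ ^ 2 * f y ^ 2 - (f' y - p y * f y) ^ 2 with hG'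
  have hG : ∀ y, HasDerivAt (fun y => p y * f y ^ 2) (G' y) y := by
    intro y
    by_cases hy : y ∈ tsupport f
    · refine ((hpd y (hsupp hy)).mul ((hf y).pow 2)).congr_deriv ?_
      simp only [hG']
      push_cast
      simp
      ring
    · have h1 : G' y = 0 := by simp [hG', hf'0 y hy, (hf0 y hy).self_of_nhds]
      rw [h1]
      refine (hasDerivAt_const y (0 : ℝ)).congr_of_eventuallyEq ?_
      filter_upwards [hf0 y hy] with x hx
      simp [hx]
  have hG'c : Continuous G' := by
    refine continuous_iff_continuousAt.2 fun y => ?_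
    by_cases hy : y ∈ tsupport f
    · have := (hpd y (hsupp hy)).continuousAt
      simp only [hG']
      have := hfc.continuousAt (x := y)
      have := hf'c.continuousAt (x := y)
      fun_prop
    · refine (continuousAt_const (y := (0 : ℝ))).congr ?_
      filter_upwards [(isClosed_tsupport f).isOpen_compl.mem_nhds hy] with x hx
      simp [hG', hf'0 x hx, (hf0 x hx).self_of_nhds]
  have hGcpt : HasCompactSupport fun y => p y * f y ^ 2 :=
    HasCompactSupport.intro hcpt fun y hy => by simp [(hf0 y hy).self_of_nhds]
  have hG'cpt : HasCompactSupport G' :=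
    HasCompactSupport.intro hcpt fun y hy => by simp [hG', hf'0 y hy, (hf0 y hy).self_of_nhds]
  have hGc : Continuous fun y => p y * f y ^ 2 :=
    continuous_iff_continuousAt.2 fun y => (hG y).continuousAt
  have hint0 : ∫ y, G' y = 0 := integral_eq_zero_of_hasDerivAt_of_integrable hG
    (hG'c.integrable_of_hasCompactSupport hG'cpt) (hGc.integrable_of_hasCompactSupport hGcpt)
  have hi1 : Integrable fun y => f' y ^ 2 :=
    (hf'c.pow 2).integrable_of_hasCompactSupport
      (HasCompactSupport.intro hcpt fun y hy => by simp [hf'0 y hy])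
  have hi2 : Integrable fun y => κ ^ 2 * f y ^ 2 :=
    (continuous_const.mul (hfc.pow 2)).integrable_of_hasCompactSupport
      (HasCompactSupport.intro hcpt fun y hy => by simp [(hf0 y hy).self_of_nhds])
  have h1 : ∫ y, G' y ≤ ∫ y, (f' y ^ 2 - κ ^ 2 * f y ^ 2) :=
    integral_mono (hG'c.integrable_of_hasCompactSupport hG'cpt) (hi1.sub hi2) fun y => by
      simp only [hG']
      nlinarith [sq_nonneg (f' y - p y * f y)]
  rw [hint0, integral_sub hi1 hi2, integral_const_mul] at h1
  linarith

/-! ### Integrals over vertical cross-sections -/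

theorem dirDeriv_eq_zero_of_notMem_tsupport {f : ℂ → ℝ} {z : ℂ} (hz : z ∉ tsupport f) (e : ℂ) :
    dirDeriv e f z = 0 := by
  rw [dirDeriv, (notMem_tsupport_iff_eventuallyEq.1 hz).fderiv_eq]
  simp

theorem hasCompactSupport_dirDeriv {f : ℂ → ℝ} (hf : HasCompactSupport f) (e : ℂ) :
    HasCompactSupport (dirDeriv e f) :=
  HasCompactSupport.intro hf fun _ hz => dirDeriv_eq_zero_of_notMem_tsupport hz e

theorem dirDeriv_mul {f g : ℂ → ℝ} (hf : ContDiff ℝ ∞ f) (hg : ContDiff ℝ ∞ g) (e z : ℂ) :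
    dirDeriv e (fun z => f z * g z) z = f z * dirDeriv e g z + g z * dirDeriv e f z := by
  rw [dirDeriv, fderiv_fun_mul (hf.differentiable (by simp) z) (hg.differentiable (by simp) z)]
  simp [dirDeriv]

theorem hasDerivAt_re_line {f : ℂ → ℝ} (hf : ContDiff ℝ ∞ f) (x y : ℝ) :
    HasDerivAt (fun x : ℝ => f (x + y * Complex.I)) (dirDeriv 1 f (x + y * Complex.I)) x := by
  simpa only [mul_one, add_comm] using hasDerivAt_comp_line hf (y * Complex.I) 1 x

theorem hasDerivAt_im_line {f : ℂ → ℝ} (hf : ContDiff ℝ ∞ f) (x y : ℝ) :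
    HasDerivAt (fun y : ℝ => f (x + y * Complex.I)) (dirDeriv Complex.I f (x + y * Complex.I)) y :=
  hasDerivAt_comp_line hf x Complex.I y

theorem hasCompactSupport_slice {f : ℂ → ℝ} (hf : HasCompactSupport f) (x : ℝ) :
    HasCompactSupport fun y : ℝ => f (x + y * Complex.I) := by
  refine HasCompactSupport.intro ((hf.isCompact).image Complex.continuous_im) fun y hy => ?_
  by_contra h
  exact hy ⟨x + y * Complex.I, subset_tsupport f h, by simp⟩

theorem integrable_slice {f : ℂ → ℝ} (hfc : Continuous f) (hf : HasCompactSupport f) (x : ℝ) :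
    Integrable fun y : ℝ => f (x + y * Complex.I) :=
  (by fun_prop : Continuous fun y : ℝ => f (x + y * Complex.I)).integrable_of_hasCompactSupport
    (hasCompactSupport_slice hf x)

theorem hasDerivAt_integral_slice {f : ℂ → ℝ} (hf : ContDiff ℝ ∞ f) (hcpt : HasCompactSupport f)
    (x : ℝ) :
    HasDerivAt (fun x : ℝ => ∫ y : ℝ, f (x + y * Complex.I))
      (∫ y : ℝ, dirDeriv 1 f (x + y * Complex.I)) x := by
  obtain ⟨R, hR⟩ := hcpt.isCompact.isBounded.subset_ball (0 : ℂ)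
  have hzero : ∀ g : ℂ → ℝ, (∀ z, z ∉ tsupport f → g z = 0) → ∀ x : ℝ,
      ∫ y : ℝ, g (x + y * Complex.I) = ∫ y in (-R)..R, g (x + y * Complex.I) := by
    intro g hg x
    rw [intervalIntegral.integral_eq_integral_of_support_subset]
    intro y hy
    have h1 : (x + y * Complex.I : ℂ) ∈ tsupport f := by
      by_contra h
      exact hy (hg _ h)
    have h2 := (Complex.abs_im_le_norm _).trans_lt (mem_ball_zero_iff.1 (hR h1))
    simp only [Complex.add_im, Complex.ofReal_im, Complex.mul_im, Complex.ofReal_re, Complex.I_im,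
      mul_one, Complex.I_re, mul_zero, add_zero, zero_add, abs_lt] at h2
    exact ⟨h2.1, h2.2.le⟩
  have hc := hf.continuous
  have hc' := (contDiff_dirDeriv hf 1).continuous
  rw [hzero _ (fun z hz => dirDeriv_eq_zero_of_notMem_tsupport hz 1)]
  simp only [hzero f (fun z hz => image_eq_zero_of_notMem_tsupport hz)]
  refine hasDerivAt_intervalIntegral_of_continuous (F := fun x y : ℝ => f (x + y * Complex.I))
    (F' := fun x y : ℝ => dirDeriv 1 f (x + y * Complex.I)) (fun x => by fun_prop) ?_
    (fun x y => hasDerivAt_re_line hf x y) _ _ _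
  unfold Function.uncurry
  fun_prop

theorem integral_slice_dirDeriv_I {f : ℂ → ℝ} (hf : ContDiff ℝ ∞ f) (hcpt : HasCompactSupport f)
    (x : ℝ) : ∫ y : ℝ, dirDeriv Complex.I f (x + y * Complex.I) = 0 :=
  integral_eq_zero_of_hasDerivAt_of_integrable (fun y => hasDerivAt_im_line hf x y)
    (integrable_slice (contDiff_dirDeriv hf _).continuous (hasCompactSupport_dirDeriv hcpt _) x)
    (integrable_slice hf.continuous hcpt x)

/-- Carleman's function `A(x) = ∫ w(x + iy)² dy`. -/
noncomputable def sliceEnergy (w : ℂ → ℝ) (x : ℝ) : ℝ := ∫ y : ℝ, w (x + y * Complex.I) ^ 2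

/-- The first derivative of Carleman's function. -/
noncomputable def sliceEnergy' (w : ℂ → ℝ) (x : ℝ) : ℝ :=
  ∫ y : ℝ, 2 * w (x + y * Complex.I) * dirDeriv 1 w (x + y * Complex.I)

/-- The second derivative of Carleman's function. -/
noncomputable def sliceEnergy'' (w : ℂ → ℝ) (x : ℝ) : ℝ :=
  ∫ y : ℝ, 2 * (dirDeriv 1 w (x + y * Complex.I) ^ 2 +
    w (x + y * Complex.I) * dirDeriv 1 (dirDeriv 1 w) (x + y * Complex.I))

theorem hasDerivAt_sliceEnergy {w : ℂ → ℝ} (hw : ContDiff ℝ ∞ w) (hcpt : HasCompactSupport w)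
    (x : ℝ) : HasDerivAt (sliceEnergy w) (sliceEnergy' w x) x := by
  have h := hasDerivAt_integral_slice (f := fun z => w z * w z) (hw.mul hw) hcpt.mul_left x
  simp only [dirDeriv_mul hw hw] at h
  have e1 : sliceEnergy w =
      fun x : ℝ => ∫ y : ℝ, w (x + y * Complex.I) * w (x + y * Complex.I) := by
    ext x; simp only [sliceEnergy, sq]
  rw [e1]
  refine h.congr_deriv ?_
  rw [sliceEnergy']; congr 1; ext y; ring

theorem hasDerivAt_sliceEnergy' {w : ℂ → ℝ} (hw : ContDiff ℝ ∞ w) (hcpt : HasCompactSupport w)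
    (x : ℝ) : HasDerivAt (sliceEnergy' w) (sliceEnergy'' w x) x := by
  have hw1 := contDiff_dirDeriv hw 1
  have h := hasDerivAt_integral_slice (f := fun z => w z * dirDeriv 1 w z) (hw.mul hw1)
    hcpt.mul_right x
  simp only [dirDeriv_mul hw hw1] at h
  have e1 : sliceEnergy' w =
      fun x : ℝ => 2 * ∫ y : ℝ, w (x + y * Complex.I) * dirDeriv 1 w (x + y * Complex.I) := by
    ext x; simp only [sliceEnergy', ← integral_const_mul, mul_assoc]
  rw [e1]
  refine (h.const_mul 2).congr_deriv ?_
  rw [sliceEnergy'', ← integral_const_mul]; congr 1; ext y; ring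

theorem continuous_sliceEnergy'' {w : ℂ → ℝ} (hw : ContDiff ℝ ∞ w) (hcpt : HasCompactSupport w) :
    Continuous (sliceEnergy'' w) := by
  have hw1 := contDiff_dirDeriv hw 1
  have hw11 := contDiff_dirDeriv hw1 1
  refine continuous_iff_continuousAt.2 fun x => HasDerivAt.continuousAt
    (hasDerivAt_integral_slice (f := fun z => 2 * (dirDeriv 1 w z ^ 2 +
      w z * dirDeriv 1 (dirDeriv 1 w) z)) (by fun_prop) ?_ x)
  refine HasCompactSupport.intro hcpt fun z hz => ?_
  simp [dirDeriv_eq_zero_of_notMem_tsupport hz 1, image_eq_zero_of_notMem_tsupport hz]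

/-- Where `w` is subharmonic, the second derivative of Carleman's function dominates the Dirichlet
integral of `w` over the cross-section. -/
theorem dirichlet_le_sliceEnergy'' {w : ℂ → ℝ} (hw : ContDiff ℝ ∞ w) (hcpt : HasCompactSupport w)
    {x : ℝ} (h0 : ∀ z, 0 ≤ w z)
    (hlap : ∀ z : ℂ, z.re = x →
      0 ≤ dirDeriv 1 (dirDeriv 1 w) z + dirDeriv Complex.I (dirDeriv Complex.I w) z) :
    2 * (∫ y : ℝ, dirDeriv 1 w (x + y * Complex.I) ^ 2) +
      2 * (∫ y : ℝ, dirDeriv Complex.I w (x + y * Complex.I) ^ 2) ≤ sliceEnergy'' w x := by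
  have hw1 := contDiff_dirDeriv hw 1
  have hwI := contDiff_dirDeriv hw Complex.I
  have hc1 := hasCompactSupport_dirDeriv hcpt 1
  have hcI := hasCompactSupport_dirDeriv hcpt Complex.I
  have hw11 := (contDiff_dirDeriv hw1 1).continuous
  have hwII := (contDiff_dirDeriv hwI Complex.I).continuous
  have hwc := hw.continuous
  have hw1c := hw1.continuous
  have hwIc := hwI.continuous
  -- integration by parts: `∫ w_y² = -∫ w w_yy`
  have h1 := integral_slice_dirDeriv_I (f := fun z => w z * dirDeriv Complex.I w z) (hw.mul hwI)
    hcpt.mul_right x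
  simp only [dirDeriv_mul hw hwI] at h1
  have i1 : Integrable fun y : ℝ => dirDeriv 1 w (x + y * Complex.I) ^ 2 :=
    integrable_slice (f := fun z => dirDeriv 1 w z ^ 2) (by fun_prop)
      (HasCompactSupport.intro hc1 fun z hz => by simp [image_eq_zero_of_notMem_tsupport hz]) x
  have i2 : Integrable fun y : ℝ => dirDeriv Complex.I w (x + y * Complex.I) ^ 2 :=
    integrable_slice (f := fun z => dirDeriv Complex.I w z ^ 2) (by fun_prop)
      (HasCompactSupport.intro hcI fun z hz => by simp [image_eq_zero_of_notMem_tsupport hz]) x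
  have i3 : Integrable fun y : ℝ =>
      w (x + y * Complex.I) * dirDeriv 1 (dirDeriv 1 w) (x + y * Complex.I) :=
    integrable_slice (f := fun z => w z * dirDeriv 1 (dirDeriv 1 w) z) (by fun_prop)
      hcpt.mul_right x
  have i4 : Integrable fun y : ℝ =>
      w (x + y * Complex.I) * dirDeriv Complex.I (dirDeriv Complex.I w) (x + y * Complex.I) :=
    integrable_slice (f := fun z => w z * dirDeriv Complex.I (dirDeriv Complex.I w) z)
      (by fun_prop) hcpt.mul_right x
  have h2 : 0 ≤ ∫ y : ℝ, (w (x + y * Complex.I) * dirDeriv 1 (dirDeriv 1 w) (x + y * Complex.I) +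
      w (x + y * Complex.I) *
        dirDeriv Complex.I (dirDeriv Complex.I w) (x + y * Complex.I)) := by
    refine integral_nonneg fun y => ?_
    rw [← mul_add]
    exact mul_nonneg (h0 _) (hlap _ (by simp))
  rw [integral_add i3 i4] at h2
  have h3 : (∫ y : ℝ, dirDeriv Complex.I w (x + y * Complex.I) ^ 2) +
      ∫ y : ℝ, w (x + y * Complex.I) *
        dirDeriv Complex.I (dirDeriv Complex.I w) (x + y * Complex.I) = 0 := by
    rw [← integral_add i2 i4, ← h1]
    congr 1; ext y; ring
  rw [sliceEnergy'', integral_const_mul, integral_add i1 i3]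
  linarith

theorem isOpen_crossSection {Ω : Set ℂ} (hΩ : IsOpen Ω) (x : ℝ) : IsOpen (crossSection Ω x) :=
  hΩ.preimage (f := fun y : ℝ => (⟨x, y⟩ : ℂ))
    (by simp only [Complex.mk_eq_add_mul_I]; fun_prop)

/-- Carleman's differential inequality `A'' ≥ 2 (π / L) A'`, from Wirtinger's inequality on the
cross-section and `2 (π / L) ∫ w w_x ≤ ∫ w_x² + (π / L)² ∫ w²`. -/
theorem sliceEnergy'_le_sliceEnergy'' {w : ℂ → ℝ} (hw : ContDiff ℝ ∞ w) (hcpt : HasCompactSupport w)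
    {x : ℝ} (h0 : ∀ z, 0 ≤ w z)
    (hlap : ∀ z : ℂ, z.re = x →
      0 ≤ dirDeriv 1 (dirDeriv 1 w) z + dirDeriv Complex.I (dirDeriv Complex.I w) z)
    {Ω : Set ℂ} (hΩ : IsOpen Ω) (hsupp : tsupport w ⊆ Ω) {L : ℝ} (hL0 : 0 < L)
    (hL : ∀ a b, Ioo a b ⊆ crossSection Ω x → b - a ≤ L) :
    2 * (Real.pi / L) * sliceEnergy' w x ≤ sliceEnergy'' w x := by
  have hw1 := contDiff_dirDeriv hw 1
  have hc1 := hasCompactSupport_dirDeriv hcpt 1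
  have hwc := hw.continuous
  have hw1c := hw1.continuous
  have hwIc := (contDiff_dirDeriv hw Complex.I).continuous
  have h1 := dirichlet_le_sliceEnergy'' hw hcpt h0 hlap
  have hslice : tsupport (fun y : ℝ => w (x + y * Complex.I)) ⊆ crossSection Ω x := by
    have h2 : tsupport (fun y : ℝ => w (x + y * Complex.I)) ⊆
        (fun y : ℝ => (x + y * Complex.I : ℂ)) ⁻¹' tsupport w :=
      closure_minimal (fun y hy => subset_tsupport w hy)
        ((isClosed_tsupport w).preimage (by fun_prop))
    intro y hy
    have h3 : (x + y * Complex.I : ℂ) ∈ Ω := hsupp (h2 hy)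
    rwa [← Complex.mk_eq_add_mul_I] at h3
  have h2 := wirtinger_inequality (isOpen_crossSection hΩ x) hL0 hL
    (fun y => hasDerivAt_im_line hw x y) (by fun_prop) (hasCompactSupport_slice hcpt x) hslice
  have i1 : Integrable fun y : ℝ => dirDeriv 1 w (x + y * Complex.I) ^ 2 :=
    integrable_slice (f := fun z => dirDeriv 1 w z ^ 2) (by fun_prop)
      (HasCompactSupport.intro hc1 fun z hz => by simp [image_eq_zero_of_notMem_tsupport hz]) x
  have i2 : Integrable fun y : ℝ => w (x + y * Complex.I) ^ 2 :=
    integrable_slice (f := fun z => w z ^ 2) (by fun_prop)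
      (HasCompactSupport.intro hcpt fun z hz => by simp [image_eq_zero_of_notMem_tsupport hz]) x
  have i3 : Integrable fun y : ℝ => 2 * w (x + y * Complex.I) * dirDeriv 1 w (x + y * Complex.I) :=
    integrable_slice (f := fun z => 2 * w z * dirDeriv 1 w z) (by fun_prop)
      (HasCompactSupport.intro hcpt fun z hz => by simp [image_eq_zero_of_notMem_tsupport hz]) x
  set κ := Real.pi / L
  have h3 : κ * sliceEnergy' w x ≤ ∫ y : ℝ, (dirDeriv 1 w (x + y * Complex.I) ^ 2 +
      κ ^ 2 * w (x + y * Complex.I) ^ 2) := by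
    rw [sliceEnergy', ← integral_const_mul]
    refine integral_mono (i3.const_mul κ) (i1.add (i2.const_mul _)) fun y => ?_
    simp only
    nlinarith [sq_nonneg (dirDeriv 1 w (x + y * Complex.I) - κ * w (x + y * Complex.I))]
  rw [integral_add i1 (i2.const_mul _), integral_const_mul] at h3
  linarith

/-! ### Carleman's differential inequality -/

theorem ofReal_sub_le_longestInterval {Ω : Set ℂ} {x a b : ℝ} (h : Ioo a b ⊆ crossSection Ω x) :
    ENNReal.ofReal (b - a) ≤ longestInterval Ω x :=
  le_iSup_of_le a (le_iSup_of_le b (le_iSup_of_le h le_rfl))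

theorem longestInterval_le {Ω : Set ℂ} {M : ℝ≥0∞} {x : ℝ} (hM : volume (crossSection Ω x) ≤ M) :
    longestInterval Ω x ≤ M :=
  iSup_le fun a => iSup_le fun b => iSup_le fun h => by
    rw [← Real.volume_Ioo]
    exact (measure_mono h).trans hM

theorem crossSection_eq_empty_of_longestInterval_eq_zero {Ω : Set ℂ} (hΩ : IsOpen Ω) {x : ℝ}
    (hl : longestInterval Ω x = 0) : crossSection Ω x = ∅ := by
  refine eq_empty_of_forall_notMem fun y hy => ?_
  obtain ⟨η, hη, hηU⟩ := Metric.isOpen_iff.1 (isOpen_crossSection hΩ x) y hy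
  rw [Real.ball_eq_Ioo] at hηU
  have h := ofReal_sub_le_longestInterval hηU
  rw [hl, nonpos_iff_eq_zero, ENNReal.ofReal_eq_zero] at h
  linarith

/-- The smooth functions to which Carleman's method applies: nonnegative, at most one, with compact
support in `Ω`, and subharmonic in the half-plane `Re z < β`. -/
structure IsCarlemanTest (Ω : Set ℂ) (β : ℝ) (w : ℂ → ℝ) : Prop where
  contDiff : ContDiff ℝ ∞ w
  hasCompactSupport : HasCompactSupport w
  tsupport_subset : tsupport w ⊆ Ω
  nonneg : ∀ z, 0 ≤ w z
  le_one : ∀ z, w z ≤ 1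
  laplacian_nonneg : ∀ z : ℂ, z.re < β →
    0 ≤ dirDeriv 1 (dirDeriv 1 w) z + dirDeriv Complex.I (dirDeriv Complex.I w) z

namespace IsCarlemanTest

variable {Ω : Set ℂ} {β : ℝ} {w : ℂ → ℝ} {M : ℝ≥0}

theorem mul_sliceEnergy'_le (h : IsCarlemanTest Ω β w) (hΩ : IsOpen Ω) {x L : ℝ} (hx : x < β)
    (hL0 : 0 < L) (hL : longestInterval Ω x ≤ ENNReal.ofReal L) :
    2 * (Real.pi / L) * sliceEnergy' w x ≤ sliceEnergy'' w x :=
  sliceEnergy'_le_sliceEnergy'' h.contDiff h.hasCompactSupport h.nonneg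
    (fun z hz => h.laplacian_nonneg z (hz ▸ hx)) hΩ h.tsupport_subset hL0 fun _ _ hab =>
      (ENNReal.ofReal_le_ofReal_iff hL0.le).1 ((ofReal_sub_le_longestInterval hab).trans hL)

theorem sliceEnergy''_nonneg (h : IsCarlemanTest Ω β w) {x : ℝ} (hx : x < β) :
    0 ≤ sliceEnergy'' w x := by
  refine le_trans ?_ (dirichlet_le_sliceEnergy'' h.contDiff h.hasCompactSupport h.nonneg
    (fun z hz => h.laplacian_nonneg z (hz ▸ hx)))
  have h1 : 0 ≤ ∫ y : ℝ, dirDeriv 1 w (x + y * Complex.I) ^ 2 :=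
    integral_nonneg fun y => sq_nonneg _
  have h2 : 0 ≤ ∫ y : ℝ, dirDeriv Complex.I w (x + y * Complex.I) ^ 2 :=
    integral_nonneg fun y => sq_nonneg _
  linarith

/-- Far to the left the function vanishes. -/
theorem exists_eq_zero_of_re_le (h : IsCarlemanTest Ω β w) :
    ∃ X < β, ∀ x y : ℝ, x ≤ X → w (x + y * Complex.I) = 0 := by
  obtain ⟨R, hR⟩ := h.hasCompactSupport.isCompact.isBounded.subset_ball (0 : ℂ)
  refine ⟨min (-R) (β - 1), (min_le_right _ _).trans_lt (by linarith), fun x y hx => ?_⟩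
  by_contra hne
  have h1 := (Complex.abs_re_le_norm _).trans_lt (mem_ball_zero_iff.1 (hR (subset_tsupport w hne)))
  simp only [Complex.add_re, Complex.ofReal_re, Complex.mul_re, Complex.I_re, mul_zero,
    Complex.ofReal_im, Complex.I_im, mul_one, sub_self, add_zero, abs_lt] at h1
  linarith [hx.trans (min_le_left _ _)]

theorem monotoneOn_sliceEnergy' (h : IsCarlemanTest Ω β w) :
    MonotoneOn (sliceEnergy' w) (Iio β) := by
  have hd := hasDerivAt_sliceEnergy' h.contDiff h.hasCompactSupport
  refine monotoneOn_of_deriv_nonneg (convex_Iio β)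
    (fun x _ => (hd x).continuousAt.continuousWithinAt)
    (fun x _ => (hd x).differentiableAt.differentiableWithinAt) fun x hx => ?_
  rw [(hd x).deriv]
  rw [interior_Iio] at hx
  exact h.sliceEnergy''_nonneg hx

theorem sliceEnergy'_nonneg (h : IsCarlemanTest Ω β w) {x : ℝ} (hx : x < β) :
    0 ≤ sliceEnergy' w x := by
  obtain ⟨X, hX, hX0⟩ := h.exists_eq_zero_of_re_le
  have h1 : sliceEnergy' w (min x X) = 0 := by
    simp [sliceEnergy', hX0 (min x X) _ (min_le_right _ _)]
  rw [← h1]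
  exact h.monotoneOn_sliceEnergy' (show min x X < β from (min_le_right _ _).trans_lt hX) hx
    (min_le_left _ _)

/-- Integrating `A'' ≥ 2 (π / M) A'` from `-∞`, where `A` and `A'` vanish. -/
theorem mul_sliceEnergy_le (h : IsCarlemanTest Ω β w) (hΩ : IsOpen Ω) (hM0 : 0 < M)
    (hM : ∀ x : ℝ, volume (crossSection Ω x) ≤ (M : ℝ≥0∞)) {x : ℝ} (hx : x < β) :
    2 * (Real.pi / M) * sliceEnergy w x ≤ sliceEnergy' w x := by
  have hd0 := hasDerivAt_sliceEnergy h.contDiff h.hasCompactSupport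
  have hd := hasDerivAt_sliceEnergy' h.contDiff h.hasCompactSupport
  have hd2 : ∀ x, HasDerivAt (fun x => sliceEnergy' w x - 2 * (Real.pi / M) * sliceEnergy w x)
      (sliceEnergy'' w x - 2 * (Real.pi / M) * sliceEnergy' w x) x := fun x =>
    (hd x).sub ((hd0 x).const_mul _)
  have hmono : MonotoneOn (fun x => sliceEnergy' w x - 2 * (Real.pi / M) * sliceEnergy w x)
      (Iio β) := by
    refine monotoneOn_of_deriv_nonneg (convex_Iio β)
      (fun x _ => (hd2 x).continuousAt.continuousWithinAt)
      (fun x _ => (hd2 x).differentiableAt.differentiableWithinAt) fun x hx => ?_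
    rw [(hd2 x).deriv, sub_nonneg]
    rw [interior_Iio] at hx
    refine h.mul_sliceEnergy'_le hΩ hx (NNReal.coe_pos.2 hM0) ?_
    rw [ENNReal.ofReal_coe_nnreal]
    exact longestInterval_le (hM x)
  obtain ⟨X, hX, hX0⟩ := h.exists_eq_zero_of_re_le
  have h1 := hmono (show min x X < β from (min_le_right _ _).trans_lt hX) hx (min_le_left _ _)
  have h2 : sliceEnergy' w (min x X) = 0 := by
    simp [sliceEnergy', hX0 (min x X) _ (min_le_right _ _)]
  have h3 : sliceEnergy w (min x X) = 0 := by
    simp [sliceEnergy, hX0 (min x X) _ (min_le_right _ _)]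
  simp only [h2, h3, mul_zero, sub_zero] at h1
  linarith

theorem sliceEnergy_le (h : IsCarlemanTest Ω β w) (hΩ : IsOpen Ω)
    (hM : ∀ x : ℝ, volume (crossSection Ω x) ≤ (M : ℝ≥0∞)) (x : ℝ) : sliceEnergy w x ≤ M := by
  have hfin : volume (crossSection Ω x) ≠ ⊤ := ne_top_of_le_ne_top ENNReal.coe_ne_top (hM x)
  have hmeas := (isOpen_crossSection hΩ x).measurableSet
  calc sliceEnergy w x ≤ ∫ y, (crossSection Ω x).indicator (fun _ => (1 : ℝ)) y := by
        refine integral_mono_of_nonneg (Eventually.of_forall fun y => sq_nonneg _)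
          ((integrable_indicator_iff hmeas).2 (integrableOn_const hfin))
          (Eventually.of_forall fun y => ?_)
        by_cases hy : y ∈ crossSection Ω x
        · simp only [indicator_of_mem hy]
          exact pow_le_one₀ (h.nonneg _) (h.le_one _)
        · have h1 : w (x + y * Complex.I) = 0 := by
            by_contra hne
            refine hy ?_
            have := h.tsupport_subset (subset_tsupport w hne)
            rwa [← Complex.mk_eq_add_mul_I] at this
          simp only [indicator_of_notMem hy, h1]
          norm_num
    _ = (volume (crossSection Ω x)).toReal := by
        rw [integral_indicator_const _ hmeas, smul_eq_mul, mul_one, measureReal_def]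
    _ ≤ M := ENNReal.toReal_le_coe_of_le_coe (hM x)

/-- Carleman's inequality `2 π / l ≤ A'' / A'`. The left side is finite, because the cross-section is
not empty where `A' > 0`. -/
theorem mul_inv_longestInterval_le (h : IsCarlemanTest Ω β w) (hΩ : IsOpen Ω)
    (hM : ∀ x : ℝ, volume (crossSection Ω x) ≤ (M : ℝ≥0∞)) {x : ℝ} (hx : x < β)
    (hpos : 0 < sliceEnergy' w x) :
    ENNReal.ofReal (2 * Real.pi) * (longestInterval Ω x)⁻¹ ≤
      ENNReal.ofReal (sliceEnergy'' w x / sliceEnergy' w x) := by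
  have hfin : longestInterval Ω x ≠ ⊤ :=
    ne_top_of_le_ne_top ENNReal.coe_ne_top (longestInterval_le (hM x))
  have hne : longestInterval Ω x ≠ 0 := by
    intro hl
    have h1 := crossSection_eq_empty_of_longestInterval_eq_zero hΩ hl
    have h2 : ∀ y : ℝ, w (x + y * Complex.I) = 0 := by
      intro y
      by_contra hy
      have h3 := h.tsupport_subset (subset_tsupport w hy)
      rw [← Complex.mk_eq_add_mul_I] at h3
      exact notMem_empty y (h1 ▸ (show y ∈ crossSection Ω x from h3))
    simp [sliceEnergy', h2] at hpos
  have hL0 := ENNReal.toReal_pos hne hfin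
  have h1 := h.mul_sliceEnergy'_le hΩ hx hL0 (ENNReal.ofReal_toReal hfin).ge
  rw [← div_eq_mul_inv, ← ENNReal.ofReal_toReal hfin, ← ENNReal.ofReal_div_of_pos hL0]
  refine ENNReal.ofReal_le_ofReal ?_
  rwa [le_div_iff₀ hpos, mul_div_assoc]

/-- Integrating `2 π / l ≤ A'' / A'` gives `exp (2 π ∫ dx / l) ≤ A'(t) / A'(s)`, and integrating
once more bounds the Carleman integral. -/
theorem carlemanIntegral_le (h : IsCarlemanTest Ω β w) (hΩ : IsOpen Ω)
    (hM : ∀ x : ℝ, volume (crossSection Ω x) ≤ (M : ℝ≥0∞)) {s t : ℝ} (hst : s ≤ t) (ht : t < β)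
    (hpos : 0 < sliceEnergy' w s) :
    carlemanIntegral Ω s t ≤
      ENNReal.ofReal ((sliceEnergy w t - sliceEnergy w s) / sliceEnergy' w s) := by
  have hd0 := hasDerivAt_sliceEnergy h.contDiff h.hasCompactSupport
  have hd := hasDerivAt_sliceEnergy' h.contDiff h.hasCompactSupport
  have hc := continuous_sliceEnergy'' h.contDiff h.hasCompactSupport
  have hc' : Continuous (sliceEnergy' w) :=
    continuous_iff_continuousAt.2 fun x => (hd x).continuousAt
  have hge : ∀ τ, s ≤ τ → τ < β → sliceEnergy' w s ≤ sliceEnergy' w τ := fun τ h1 h2 =>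
    h.monotoneOn_sliceEnergy' (show s < β from h1.trans_lt h2) h2 h1
  have hexp : ∀ τ ∈ Ioc s t, EReal.exp ((ENNReal.ofReal (2 * Real.pi) *
      ∫⁻ x in Ioc s τ, (longestInterval Ω x)⁻¹ : ℝ≥0∞) : EReal) ≤
      ENNReal.ofReal (sliceEnergy' w τ / sliceEnergy' w s) := by
    intro τ hτ
    have hτβ : τ < β := hτ.2.trans_lt ht
    have hposI : ∀ x ∈ Icc s τ, 0 < sliceEnergy' w x := fun x hx =>
      hpos.trans_le (hge x hx.1 (hx.2.trans_lt hτβ))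
    have hcont : ContinuousOn (fun x => sliceEnergy'' w x / sliceEnergy' w x) (Icc s τ) :=
      hc.continuousOn.div hc'.continuousOn fun x hx => (hposI x hx).ne'
    have h1 : ENNReal.ofReal (2 * Real.pi) * ∫⁻ x in Ioc s τ, (longestInterval Ω x)⁻¹ ≤
        ENNReal.ofReal (Real.log (sliceEnergy' w τ) - Real.log (sliceEnergy' w s)) := by
      rw [← lintegral_const_mul' _ _ ENNReal.ofReal_ne_top]
      have h2 : ∫ x in s..τ, sliceEnergy'' w x / sliceEnergy' w x =
          Real.log (sliceEnergy' w τ) - Real.log (sliceEnergy' w s) := by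
        refine intervalIntegral.integral_eq_sub_of_hasDerivAt
          (f := fun x => Real.log (sliceEnergy' w x)) (fun x hx => ?_) ?_
        · rw [uIcc_of_le hτ.1.le] at hx
          exact (hd x).log (hposI x hx).ne'
        · exact ContinuousOn.intervalIntegrable (by rwa [uIcc_of_le hτ.1.le])
      rw [← h2, intervalIntegral.integral_of_le hτ.1.le, ofReal_integral_eq_lintegral_ofReal]
      · refine setLIntegral_mono' measurableSet_Ioc fun x hx => ?_
        exact h.mul_inv_longestInterval_le hΩ hM (hx.2.trans_lt hτβ) (hposI x ⟨hx.1.le, hx.2⟩)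
      · exact (hcont.integrableOn_Icc).mono_set Ioc_subset_Icc_self
      · refine (ae_restrict_iff' measurableSet_Ioc).2 (Eventually.of_forall fun x hx => ?_)
        exact div_nonneg (h.sliceEnergy''_nonneg (hx.2.trans_lt hτβ)) (hposI x ⟨hx.1.le, hx.2⟩).le
    have h3 : sliceEnergy' w s ≤ sliceEnergy' w τ := hge τ hτ.1.le hτβ
    have h4 : 0 ≤ Real.log (sliceEnergy' w τ) - Real.log (sliceEnergy' w s) :=
      sub_nonneg.2 (Real.log_le_log hpos h3)
    refine (EReal.exp_monotone (EReal.coe_ennreal_le_coe_ennreal_iff.2 h1)).trans_eq ?_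
    rw [EReal.coe_ennreal_ofReal, max_eq_left h4, EReal.exp_coe, Real.exp_sub,
      Real.exp_log hpos, Real.exp_log (hpos.trans_le h3)]
  rw [carlemanIntegral]
  refine (setLIntegral_mono' measurableSet_Ioc hexp).trans_eq ?_
  rw [← ofReal_integral_eq_lintegral_ofReal]
  · rw [← intervalIntegral.integral_of_le hst, intervalIntegral.integral_div,
      intervalIntegral.integral_eq_sub_of_hasDerivAt (fun x _ => hd0 x)
        (hc'.intervalIntegrable _ _)]
  · exact ((hc'.div_const _).integrableOn_Icc).mono_set Ioc_subset_Icc_self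
  · refine (ae_restrict_iff' measurableSet_Ioc).2 (Eventually.of_forall fun x hx => ?_)
    exact div_nonneg (h.sliceEnergy'_nonneg (hx.2.trans_lt ht)) hpos.le

end IsCarlemanTest

/-! ### Smooth approximations of the Perron family -/

theorem lintegral_complex {f : ℂ → ℝ≥0∞} (hf : Measurable f) :
    ∫⁻ z, f z = ∫⁻ x : ℝ, ∫⁻ y : ℝ, f (x + y * Complex.I) := by
  rw [← (Complex.volume_preserving_equiv_real_prod.symm).lintegral_comp hf,
    Measure.volume_eq_prod, lintegral_prod
      (fun p : ℝ × ℝ => f (Complex.measurableEquivRealProd.symm p))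
      (hf.comp (MeasurableEquiv.measurable _)).aemeasurable]
  simp only [Complex.measurableEquivRealProd_symm_apply, Complex.mk_eq_add_mul_I]

/-- The square of a function with the sub-mean value inequality has it as well, since
`w² ≥ 2 t w - t²` with `t` the value at the centre. -/
theorem sq_le_circleAverage_sq {w : ℂ → ℝ} (hw : Continuous w) (h0 : ∀ z, 0 ≤ w z) {z : ℂ} {r : ℝ}
    (h : w z ≤ Real.circleAverage w z r) : w z ^ 2 ≤ Real.circleAverage (fun ζ => w ζ ^ 2) z r := by
  have h1 : Real.circleAverage (fun ζ => 2 * w z * w ζ - w z ^ 2) z r ≤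
      Real.circleAverage (fun ζ => w ζ ^ 2) z r :=
    Real.circleAverage_mono (Continuous.continuousOn (by fun_prop)).circleIntegrable'
      (Continuous.continuousOn (by fun_prop)).circleIntegrable' fun ζ _ => by
        nlinarith [sq_nonneg (w ζ - w z)]
  have h2 : Real.circleAverage (fun ζ => 2 * w z * w ζ - w z ^ 2) z r =
      2 * w z * Real.circleAverage w z r - w z ^ 2 := by
    rw [Real.circleAverage_fun_sub (Continuous.continuousOn (by fun_prop)).circleIntegrable'
      (Continuous.continuousOn (by fun_prop)).circleIntegrable', Real.circleAverage_const]
    congr 1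
    exact Real.circleAverage_fun_smul (a := 2 * w z)
  nlinarith [h0 z]

namespace IsCarlemanTest

variable {Ω : Set ℂ} {β : ℝ} {w : ℂ → ℝ} {M : ℝ≥0}

theorem monotoneOn_sliceEnergy (h : IsCarlemanTest Ω β w) :
    MonotoneOn (sliceEnergy w) (Iio β) := by
  have hd := hasDerivAt_sliceEnergy h.contDiff h.hasCompactSupport
  refine monotoneOn_of_deriv_nonneg (convex_Iio β)
    (fun x _ => (hd x).continuousAt.continuousWithinAt)
    (fun x _ => (hd x).differentiableAt.differentiableWithinAt) fun x hx => ?_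
  rw [(hd x).deriv]
  rw [interior_Iio] at hx
  exact h.sliceEnergy'_nonneg hx

/-- The mean of `w²` over the disc of radius `r` about `z` is at least `w(z)²`; since `A` is
nondecreasing, the integral of `w²` over the disc is at most `2 r A(Re z + r)`. -/
theorem mul_sq_le_sliceEnergy (h : IsCarlemanTest Ω β w) {z : ℂ} {r : ℝ} (hr : 0 < r)
    (hz : z.re + r < β) (hsub : ∀ ρ > 0, ρ < r → w z ≤ Real.circleAverage w z ρ) :
    Real.pi * r / 2 * w z ^ 2 ≤ sliceEnergy w (z.re + r) := by
  have hc := h.contDiff.continuous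
  have hA0 : 0 ≤ sliceEnergy w (z.re + r) := integral_nonneg fun y => sq_nonneg _
  have h1 := volume_ball_mul_le_lintegral (g := fun ζ => w ζ ^ 2) (N := 1) (by fun_prop)
    (fun ζ => sq_nonneg _) (fun ζ => pow_le_one₀ (h.nonneg _) (h.le_one _)) (z := z) (R := r)
    fun ρ hρ hρr => sq_le_circleAverage_sq hc h.nonneg (hsub ρ hρ hρr)
  have h2 : ∫⁻ ζ in Metric.ball z r, ENNReal.ofReal (w ζ ^ 2) ≤
      ENNReal.ofReal (sliceEnergy w (z.re + r)) * ENNReal.ofReal (2 * r) := by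
    rw [← lintegral_indicator measurableSet_ball, lintegral_complex
      (Measurable.indicator (by fun_prop) measurableSet_ball)]
    have h3 : ENNReal.ofReal (sliceEnergy w (z.re + r)) * ENNReal.ofReal (2 * r) =
        ∫⁻ x, (Ioc (z.re - r) (z.re + r)).indicator
          (fun _ => ENNReal.ofReal (sliceEnergy w (z.re + r))) x := by
      rw [lintegral_indicator_const measurableSet_Ioc, Real.volume_Ioc]
      congr 2; ring
    rw [h3]
    refine lintegral_mono fun x => ?_
    by_cases hx : x ∈ Ioc (z.re - r) (z.re + r)
    · rw [indicator_of_mem hx]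
      calc ∫⁻ y : ℝ, (Metric.ball z r).indicator (fun ζ => ENNReal.ofReal (w ζ ^ 2))
            (x + y * Complex.I)
          ≤ ∫⁻ y : ℝ, ENNReal.ofReal (w (x + y * Complex.I) ^ 2) :=
            lintegral_mono fun y => indicator_le_self _ _ _
        _ = ENNReal.ofReal (sliceEnergy w x) := by
            rw [sliceEnergy, ofReal_integral_eq_lintegral_ofReal
              (integrable_slice (f := fun ζ => w ζ ^ 2) (by fun_prop)
                (HasCompactSupport.intro h.hasCompactSupport fun ζ hζ => by
                  simp [image_eq_zero_of_notMem_tsupport hζ]) x)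
              (Eventually.of_forall fun y => sq_nonneg _)]
        _ ≤ _ := ENNReal.ofReal_le_ofReal
            (h.monotoneOn_sliceEnergy (show x < β from hx.2.trans_lt hz) hz hx.2)
    · rw [indicator_of_notMem hx, nonpos_iff_eq_zero]
      refine (lintegral_congr fun y => indicator_of_notMem (fun hy => hx ?_) _).trans lintegral_zero
      have h4 := (Complex.abs_re_le_norm _).trans_lt (mem_ball_iff_norm.1 hy)
      simp only [Complex.sub_re, Complex.add_re, Complex.ofReal_re, Complex.mul_re, Complex.I_re,
        mul_zero, Complex.ofReal_im, Complex.I_im, mul_one, sub_self, add_zero, abs_lt] at h4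
      constructor <;> linarith
  have h3 := h1.trans h2
  rw [Complex.volume_ball] at h3
  have h4 : ENNReal.ofReal (w z ^ 2 * (r ^ 2 * Real.pi)) ≤
      ENNReal.ofReal (sliceEnergy w (z.re + r) * (2 * r)) := by
    refine le_trans (le_of_eq ?_) (h3.trans (le_of_eq ?_))
    · rw [ENNReal.ofReal_mul (sq_nonneg _), ENNReal.ofReal_mul (by positivity),
        ENNReal.ofReal_pow hr.le]
      congr 2
      rw [ENNReal.ofReal, Real.toNNReal_of_nonneg Real.pi_pos.le]; rfl
    · rw [ENNReal.ofReal_mul hA0]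
  rw [ENNReal.ofReal_le_ofReal_iff (by positivity)] at h4
  have h5 : r * (Real.pi * r / 2 * w z ^ 2) ≤ r * sliceEnergy w (z.re + r) := by nlinarith
  exact le_of_mul_le_mul_left h5 hr

end IsCarlemanTest

variable {Ω : Set ℂ} {M : ℝ≥0} {v : ℂ → ℝ} {b : ℝ}

/-- Truncating a member of the Perron family at the level `δ` makes its support compact in `Ω`, so
that a mollification is still supported in `Ω`. -/
theorem PerronFamily.exists_isCarlemanTest (hΩ : IsOpen Ω)
    (hM : ∀ x : ℝ, volume (crossSection Ω x) ≤ (M : ℝ≥0∞))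
    (hv : PerronFamily Ω ((boundaryBeyond Ω b).indicator 1) v) {β δ : ℝ} (hβ : β < b)
    (hδ : 0 < δ) :
    ∃ w, IsCarlemanTest Ω β w ∧ (∀ z : ℂ, z.re < β → excess Ω v δ z ≤ w z) ∧
      ∀ z r, 0 < r → z.re + r ≤ β → w z ≤ Real.circleAverage w z r := by
  set b' := (β + b) / 2 with hb'
  have hβb' : β < b' := by rw [hb']; linarith
  have hb'b : b' < b := by rw [hb']; linarith
  set K : Set ℂ := {z | z.re ≤ b' ∧ δ ≤ excess Ω v 0 z} with hK
  have hKc : IsCompact K := hv.isCompact_superlevel hΩ hM hb'b hδ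
  have hKΩ : K ⊆ Ω := by
    intro z hz
    by_contra hzΩ
    have := hz.2
    rw [excess_of_notMem v 0 hzΩ] at this
    linarith
  obtain ⟨ε₁, hε₁, hε₁Ω⟩ := hKc.exists_cthickening_subset_open hΩ hKΩ
  set ε := min ε₁ (b' - β) with hε
  have hεpos : 0 < ε := lt_min hε₁ (by linarith)
  have hεb : ε ≤ b' - β := min_le_right _ _
  set H : Set ℂ := Complex.re ⁻¹' Iic b' with hH
  set g : ℂ → ℝ := H.indicator (excess Ω v δ) with hg
  have hle0 : ∀ z, excess Ω v δ z ≤ excess Ω v 0 z := fun z =>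
    indicator_le_indicator (max_le_max_right 0 (by linarith))
  have hgK : ∀ z, z ∉ K → g z = 0 := by
    intro z hz
    by_cases hzH : z ∈ H
    · rw [hg, indicator_of_mem hzH]
      by_cases hzΩ : z ∈ Ω
      · have h1 : ¬ δ ≤ excess Ω v 0 z := fun h => hz ⟨hzH, h⟩
        rw [excess_of_mem v 0 hzΩ, not_le, max_lt_iff] at h1
        rw [excess_of_mem v δ hzΩ]
        exact max_eq_right (by linarith [h1.1])
      · exact excess_of_notMem v δ hzΩ
    · exact indicator_of_notMem hzH _
  have hgsub : ∀ z r, 0 < r → z.re + r ≤ b' → g z ≤ Real.circleAverage g z r := by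
    intro z r hr hz
    have hmem : ∀ w ∈ Metric.closedBall z r, w ∈ H := by
      intro w hw
      have h1 := (Complex.abs_re_le_norm (w - z)).trans (mem_closedBall_iff_norm.1 hw)
      rw [Complex.sub_re, abs_le] at h1
      change w.re ≤ b'
      linarith
    have heq : EqOn g (excess Ω v δ) (Metric.sphere z |r|) := fun w hw =>
      indicator_of_mem (hmem w (Metric.sphere_subset_closedBall (by rwa [abs_of_pos hr] at hw))) _
    rw [Real.circleAverage_congr_sphere heq, hg,
      indicator_of_mem (hmem z (Metric.mem_closedBall_self hr.le))]
    refine Carleman.excess_le_circleAverage (U := {z : ℂ | z.re < b}) hΩ hv.subharmonicOn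
      hv.bddAbove (fun ζ hζ ε hε => ?_) hr fun w hw => lt_of_le_of_lt (hmem w hw) hb'b
    exact (hv.limsup_le_zero ζ hζ ε hε).mono fun y hy => by linarith
  obtain ⟨w, hw, hw0, hw1, hwz, hws, hwg⟩ := exists_smooth_approx (g := g)
    ((measurable_excess hΩ hv.subharmonicOn.usc δ).indicator
      (measurableSet_Iic.preimage Complex.measurable_re))
    (fun z => indicator_nonneg (fun _ _ => excess_nonneg Ω v δ _) _)
    (fun z => (indicator_le_self' (fun _ _ => excess_nonneg Ω v δ _) z).trans
      ((hle0 z).trans (hv.le_one hΩ hM z))) hgK hgsub hεpos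
  have hts : tsupport w ⊆ Metric.cthickening ε₁ K := by
    refine closure_minimal (fun z hz => ?_) Metric.isClosed_cthickening
    have h1 : z ∈ Metric.thickening ε K := by
      by_contra h
      exact hz (hwz z h)
    exact Metric.cthickening_mono (min_le_left _ _) K (Metric.thickening_subset_cthickening _ _ h1)
  refine ⟨w, ⟨hw, ?_, hts.trans hε₁Ω, hw0, hw1, fun z hz => ?_⟩, fun z hz => ?_,
    fun z r hr hz => hws z r hr (by linarith)⟩
  · exact HasCompactSupport.of_support_subset_isCompact hKc.cthickening
      ((subset_tsupport w).trans hts)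
  · exact laplacian_nonneg_of_le_circleAverage hw (sub_pos.2 hz) fun r hr hrβ =>
      hws z r hr (by linarith)
  · have h1 := hwg z (by linarith)
    rwa [hg, indicator_of_mem (show z ∈ H from (hz.trans hβb').le)] at h1

/-! ### The estimate of the harmonic measure -/

theorem carlemanIntegral_le_of_forall_lt {s : ℝ} {C : ℝ≥0∞}
    (h : ∀ t, s ≤ t → t < b → carlemanIntegral Ω s t ≤ C) : carlemanIntegral Ω s b ≤ C := by
  rcases le_or_gt b s with hbs | hsb
  · simp [carlemanIntegral, Ioc_eq_empty (not_lt.2 hbs)]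
  obtain ⟨t, htmono, ht, htlim⟩ := exists_seq_strictMono_tendsto' hsb
  have hunion : Ioo s b = ⋃ n, Ioc s (t n) := by
    ext x
    simp only [mem_iUnion]
    constructor
    · intro hx
      obtain ⟨n, hn⟩ := (htlim.eventually_const_lt hx.2).exists
      exact ⟨n, hx.1, hn.le⟩
    · rintro ⟨n, hn⟩
      exact ⟨hn.1, hn.2.trans_lt (ht n).2⟩
  rw [carlemanIntegral, ← restrict_Ioo_eq_restrict_Ioc, hunion, setLIntegral_iUnion_of_directed]
  · exact iSup_le fun n => h (t n) (ht n).1.le (ht n).2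
  · exact (show Monotone fun n => Ioc s (t n) from fun m n hmn =>
      Ioc_subset_Ioc_right (htmono.monotone hmn)).directed_le

/-- Near the centre of a disc contained in `Ω` the cross-sections are long. -/
theorem ofReal_le_longestInterval_of_ball {z₀ : ℂ} {r₀ : ℝ} (hr₀ : 0 < r₀)
    (hball : Metric.ball z₀ r₀ ⊆ Ω) {x : ℝ} (hx : |x - z₀.re| ≤ r₀ / 5) :
    ENNReal.ofReal (9 / 5 * r₀) ≤ longestInterval Ω x := by
  have h : Ioo (z₀.im - 9 / 10 * r₀) (z₀.im + 9 / 10 * r₀) ⊆ crossSection Ω x := by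
    intro y hy
    refine hball (mem_ball_iff_norm.2 ?_)
    refine lt_of_pow_lt_pow_left₀ 2 hr₀.le ?_
    rw [← Complex.normSq_eq_norm_sq, Complex.normSq_apply]
    simp only [Complex.sub_re, Complex.sub_im]
    rw [abs_le] at hx
    nlinarith [hx.1, hx.2, hy.1, hy.2]
  have h1 := ofReal_sub_le_longestInterval h
  rwa [show z₀.im + 9 / 10 * r₀ - (z₀.im - 9 / 10 * r₀) = 9 / 5 * r₀ by ring] at h1

theorem two_mul_le_of_ball {z₀ : ℂ} {r₀ : ℝ} (hball : Metric.ball z₀ r₀ ⊆ Ω)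
    (hM : ∀ x : ℝ, volume (crossSection Ω x) ≤ (M : ℝ≥0∞)) : 2 * r₀ ≤ M := by
  have h : Ioo (z₀.im - r₀) (z₀.im + r₀) ⊆ crossSection Ω z₀.re := by
    intro y hy
    refine hball (mem_ball_iff_norm.2 ?_)
    have h1 : (⟨z₀.re, y⟩ : ℂ) - z₀ = (y - z₀.im : ℝ) * Complex.I := by
      apply Complex.ext <;> simp
    rw [h1, norm_mul, Complex.norm_I, mul_one, Complex.norm_real, Real.norm_eq_abs, abs_lt]
    constructor <;> linarith [hy.1, hy.2]
  have h1 := (ofReal_sub_le_longestInterval h).trans (longestInterval_le (hM _))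
  rw [← ENNReal.ofReal_coe_nnreal, ENNReal.ofReal_le_ofReal_iff M.coe_nonneg] at h1
  linarith

/-- Moving the left endpoint of the Carleman integral from `x₀` to `x₀ + r₀ / 5` costs a factor
`e`, because `2 π / l ≤ 5 / r₀` in between. -/
theorem carlemanIntegral_le_add {z₀ : ℂ} {r₀ : ℝ} (hr₀ : 0 < r₀) (hball : Metric.ball z₀ r₀ ⊆ Ω) :
    carlemanIntegral Ω z₀.re b ≤ ENNReal.ofReal (Real.exp 1) * ENNReal.ofReal (r₀ / 5) +
      ENNReal.ofReal (Real.exp 1) * carlemanIntegral Ω (z₀.re + r₀ / 5) b := by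
  set s := z₀.re + r₀ / 5 with hs
  have hinner : ENNReal.ofReal (2 * Real.pi) * ∫⁻ x in Ioc z₀.re s, (longestInterval Ω x)⁻¹ ≤
      ENNReal.ofReal 1 := by
    have h1 : ∫⁻ x in Ioc z₀.re s, (longestInterval Ω x)⁻¹ ≤
        ∫⁻ _ in Ioc z₀.re s, (ENNReal.ofReal (9 / 5 * r₀))⁻¹ := by
      refine setLIntegral_mono' measurableSet_Ioc fun x hx => ?_
      refine ENNReal.inv_le_inv.2 (ofReal_le_longestInterval_of_ball hr₀ hball ?_)
      rw [abs_le]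
      constructor <;> linarith [hx.1, hx.2]
    rw [setLIntegral_const, Real.volume_Ioc, ← ENNReal.ofReal_inv_of_pos (by positivity),
      ← ENNReal.ofReal_mul (by positivity)] at h1
    refine (mul_le_mul_right h1 _).trans ?_
    rw [← ENNReal.ofReal_mul (by positivity)]
    refine ENNReal.ofReal_le_ofReal ?_
    have : 2 * Real.pi * ((9 / 5 * r₀)⁻¹ * (s - z₀.re)) = 2 * Real.pi / 9 := by
      rw [hs]; field_simp; ring
    rw [this]
    linarith [Real.pi_lt_four]
  have hexp : EReal.exp ((ENNReal.ofReal (2 * Real.pi) *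
      ∫⁻ x in Ioc z₀.re s, (longestInterval Ω x)⁻¹ : ℝ≥0∞) : EReal) ≤
      ENNReal.ofReal (Real.exp 1) := by
    refine (EReal.exp_monotone (EReal.coe_ennreal_le_coe_ennreal_iff.2 hinner)).trans_eq ?_
    rw [EReal.coe_ennreal_ofReal, max_eq_left zero_le_one, EReal.exp_coe]
  rw [carlemanIntegral]
  refine (lintegral_mono_set (t := Ioc z₀.re s ∪ Ioc s b) fun x hx => ?_).trans
    ((lintegral_union_le _ _ _).trans (add_le_add ?_ ?_))
  · rcases le_or_gt x s with h | h
    · exact Or.inl ⟨hx.1, h⟩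
    · exact Or.inr ⟨h, hx.2⟩
  · calc _ ≤ ∫⁻ _ in Ioc z₀.re s, ENNReal.ofReal (Real.exp 1) := by
          refine setLIntegral_mono' measurableSet_Ioc fun x hx => le_trans ?_ hexp
          refine EReal.exp_monotone (EReal.coe_ennreal_le_coe_ennreal_iff.2 ?_)
          gcongr
          exact hx.2
      _ = _ := by
          rw [setLIntegral_const, Real.volume_Ioc]
          congr 2
          rw [hs]; ring
  · rw [carlemanIntegral, ← lintegral_const_mul' _ _ ENNReal.ofReal_ne_top]
    refine setLIntegral_mono' measurableSet_Ioc fun x hx => ?_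
    have h1 : ∫⁻ y in Ioc z₀.re x, (longestInterval Ω y)⁻¹ ≤
        (∫⁻ y in Ioc z₀.re s, (longestInterval Ω y)⁻¹) +
          ∫⁻ y in Ioc s x, (longestInterval Ω y)⁻¹ := by
      rw [← Ioc_union_Ioc_eq_Ioc (show z₀.re ≤ s by rw [hs]; linarith) hx.1.le]
      exact lintegral_union_le _ _ _
    refine (EReal.exp_monotone (EReal.coe_ennreal_le_coe_ennreal_iff.2
      (mul_le_mul_right h1 _))).trans ?_
    rw [mul_add, EReal.coe_ennreal_add, EReal.exp_add]
    gcongr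

/-- Carleman's inequality for a member of the Perron family, on the right of `x₀ + r₀ / 5`. -/
theorem PerronFamily.carlemanIntegral_le (hΩ : IsOpen Ω)
    (hM : ∀ x : ℝ, volume (crossSection Ω x) ≤ (M : ℝ≥0∞))
    (hv : PerronFamily Ω ((boundaryBeyond Ω b).indicator 1) v) {z₀ : ℂ} (hz₀ : z₀ ∈ Ω) {r : ℝ}
    (hr : 0 < r) {c : ℝ} (hc : 0 < c) (hcv : c < v z₀) {a : ℝ} (ha : a = Real.pi * r / 2 * c ^ 2) :
    carlemanIntegral Ω (z₀.re + r) b ≤ ENNReal.ofReal (M * (M - a) / (2 * Real.pi * a)) := by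
  have ha0 : 0 < a := by rw [ha]; positivity
  refine carlemanIntegral_le_of_forall_lt fun t hst htb => ?_
  obtain ⟨β, htβ, hβb⟩ := exists_between htb
  obtain ⟨w, hw, hwv, hwsub⟩ := hv.exists_isCarlemanTest hΩ hM hβb (sub_pos.2 hcv)
  have hsβ : z₀.re + r < β := hst.trans_lt htβ
  have hcw : c ≤ w z₀ := by
    refine le_trans ?_ (hwv z₀ (by linarith))
    rw [excess_of_mem v _ hz₀]
    exact le_trans (by linarith) (le_max_left _ _)
  have haA : a ≤ sliceEnergy w (z₀.re + r) := by
    refine le_trans ?_ (hw.mul_sq_le_sliceEnergy hr hsβ fun ρ hρ hρr =>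
      hwsub z₀ ρ hρ (by linarith))
    rw [ha]
    gcongr
  have hAM := hw.sliceEnergy_le hΩ hM
  have hM0 : (0 : ℝ) < M := (ha0.trans_le haA).trans_le (hAM _)
  have hA' := hw.mul_sliceEnergy_le hΩ (NNReal.coe_pos.1 hM0) hM hsβ
  have haA' : 2 * (Real.pi / M) * a ≤ sliceEnergy' w (z₀.re + r) :=
    le_trans (by gcongr) hA'
  have hpos : 0 < 2 * (Real.pi / M) * a := by positivity
  refine (hw.carlemanIntegral_le hΩ hM hst htβ (hpos.trans_le haA')).trans
    (ENNReal.ofReal_le_ofReal ?_)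
  have hnum : 0 ≤ (M : ℝ) - a := sub_nonneg.2 (haA.trans (hAM _))
  calc (sliceEnergy w t - sliceEnergy w (z₀.re + r)) / sliceEnergy' w (z₀.re + r)
      ≤ (M - a) / (2 * (Real.pi / M) * a) := by
        gcongr
        exact hAM t
    _ = M * (M - a) / (2 * Real.pi * a) := by field_simp

/-- The comparison of constants. The factor `99 / 100` allows for the truncation of `v`. -/
theorem exp_mul_add_le {r₀ M m a : ℝ} (hr₀ : 0 < r₀) (hM : 2 * r₀ ≤ M) (hm : 0 < m)
    (ha : a = Real.pi * (r₀ / 5) / 2 * (99 / 100 * m) ^ 2) :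
    Real.exp 1 * (r₀ / 5) + Real.exp 1 * (M * (M - a) / (2 * Real.pi * a)) ≤
      (3 * M / m) ^ 2 / (2 * Real.pi * r₀) := by
  have hpi := Real.pi_pos
  have ha0 : 0 < a := by rw [ha]; positivity
  have h1 : M * (M - a) / (2 * Real.pi * a) = M ^ 2 / (2 * Real.pi * a) - M / (2 * Real.pi) := by
    field_simp
  have h2 : r₀ / 5 ≤ M / (2 * Real.pi) := by
    rw [div_le_div_iff₀ (by norm_num) (by positivity)]
    nlinarith [Real.pi_lt_four]
  have h3 : Real.exp 1 * (M ^ 2 / (2 * Real.pi * a)) ≤ (3 * M / m) ^ 2 / (2 * Real.pi * r₀) := by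
    have e1 : Real.exp 1 * (M ^ 2 / (2 * Real.pi * a)) =
        M ^ 2 / (2 * Real.pi * r₀ * m ^ 2) * (Real.exp 1 * 10 / (Real.pi * (99 / 100) ^ 2)) := by
      rw [ha]; field_simp; ring
    have e2 : (3 * M / m) ^ 2 / (2 * Real.pi * r₀) = M ^ 2 / (2 * Real.pi * r₀ * m ^ 2) * 9 := by
      field_simp; ring
    rw [e1, e2]
    refine mul_le_mul_of_nonneg_left ?_ (by positivity)
    -- this is `10 e ≤ 9 π (0.99)²`
    rw [div_le_iff₀ (by positivity)]
    linarith [Real.exp_one_lt_d9, Real.pi_gt_d2]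
  have h4 := Real.exp_pos 1
  rw [h1]
  nlinarith

end Carleman

theorem mainTheorem8 (Ω : Set ℂ) (hΩ_open : IsOpen Ω) (hΩ_conn : IsConnected Ω)
    (M : ℝ≥0) (hM : ∀ x : ℝ, volume (Carleman.crossSection Ω x) ≤ (M : ℝ≥0∞))
    (z₀ : ℂ) (r₀ : ℝ) (hr₀ : 0 < r₀) (hball : Metric.ball z₀ r₀ ⊆ Ω)
    (b : ℝ) (hb : z₀.re < b) :
    Carleman.harmonicMeasure Ω z₀ (Carleman.boundaryBeyond Ω b) ≤
      3 * (M : ℝ≥0∞) /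
        (ENNReal.ofReal (2 * Real.pi * r₀) * Carleman.carlemanIntegral Ω z₀.re b) ^ (1 / 2 : ℝ) := by
  refine iSup₂_le fun v hv => ?_
  rcases le_or_gt (v z₀) 0 with hv0 | hv0
  · rw [ENNReal.ofReal_of_nonpos hv0]
    exact zero_le
  have hz₀ : z₀ ∈ Ω := hball (Metric.mem_ball_self hr₀)
  have hM2 := Carleman.two_mul_le_of_ball hball hM
  have hM0 : (0 : ℝ) < M := by linarith
  have hM0' : (M : ℝ≥0∞) ≠ 0 := by
    rw [ENNReal.coe_ne_zero, ← NNReal.coe_ne_zero]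
    exact hM0.ne'
  have hv1 : v z₀ ≤ 1 := by
    have h := (Carleman.excess_le_iff (zero_le_one)).1 (hv.le_one hΩ_open hM) z₀ hz₀
    linarith
  -- the lower bound for `A (x₀ + r₀ / 5)` obtained from `w z₀ ≥ (99 / 100) v z₀`
  set a := Real.pi * (r₀ / 5) / 2 * (99 / 100 * v z₀) ^ 2 with ha
  have haM : a ≤ M := by
    have h1 : (99 / 100 * v z₀) ^ 2 ≤ 1 := pow_le_one₀ (by positivity) (by linarith)
    have h2 : Real.pi * (r₀ / 5) / 2 * (99 / 100 * v z₀) ^ 2 ≤ Real.pi * (r₀ / 5) / 2 :=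
      mul_le_of_le_one_right (by positivity) h1
    nlinarith [Real.pi_lt_four]
  have h1 := hv.carlemanIntegral_le hΩ_open hM hz₀ (r := r₀ / 5) (by positivity)
    (c := 99 / 100 * v z₀) (by positivity) (by linarith) ha
  have h2 : Carleman.carlemanIntegral Ω z₀.re b ≤
      ENNReal.ofReal ((3 * M / v z₀) ^ 2 / (2 * Real.pi * r₀)) := by
    refine (Carleman.carlemanIntegral_le_add hr₀ hball).trans ?_
    refine (add_le_add_right (mul_le_mul_right h1 _) _).trans ?_
    rw [← ENNReal.ofReal_mul (Real.exp_pos 1).le, ← ENNReal.ofReal_mul (Real.exp_pos 1).le,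
      ← ENNReal.ofReal_add (by positivity) ?_]
    · exact ENNReal.ofReal_le_ofReal (Carleman.exp_mul_add_le hr₀ hM2 hv0 ha)
    · have := sub_nonneg.2 haM
      positivity
  have h3 : (ENNReal.ofReal (2 * Real.pi * r₀) *
      Carleman.carlemanIntegral Ω z₀.re b) ^ (1 / 2 : ℝ) ≤
      ENNReal.ofReal (3 * M / v z₀) := by
    rw [one_div, ENNReal.rpow_inv_le_iff two_pos]
    refine (mul_le_mul_right h2 _).trans_eq ?_
    rw [← ENNReal.ofReal_mul (by positivity), mul_div_cancel₀ _ (by positivity),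
      ENNReal.ofReal_pow (by positivity)]
    norm_num
  rw [ENNReal.le_div_iff_mul_le (Or.inr (mul_ne_zero (by norm_num) hM0'))
    (Or.inr (ENNReal.mul_ne_top (by norm_num) ENNReal.coe_ne_top))]
  refine (mul_le_mul_right h3 _).trans_eq ?_
  rw [← ENNReal.ofReal_mul hv0.le, mul_div_cancel₀ _ hv0.ne', ENNReal.ofReal_mul (by norm_num),
    ENNReal.ofReal_coe_nnreal]
  norm_num
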